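/- Let $k$ be a field of characteristic $p>0$, let $I\subseteq R=k[x_1,\dots,x_n]$ be a face ideal, i.e. an ideal generated by square-free monomials, and put $\widehat S=k[[x_1,\dots,x_n]]/I\,k[[x_1,\dots,x_n]]$. For an ideal $H$ in a commutative ring of characteristic $p$ write $H^{[p]}$ for the ideal generated by the $p$-th powers of the elements of $H$. For $d\in\{0,1\}^n$ let $\operatorname{supp}(d)=\{i: d_i=1\}$, $x^d=\prod_{i\in \operatorname{supp}(d)}x_i$, and let $d^+\in\{0,1\}^n$ be the complementary vector, $d^+_i=1-d_i$. Let $\phi_d:R\to R_d=k[x_j: j\in\operatorname{supp}(d)]$ be the surjective $k$-algebra homomorphism with $\phi_d(x_j)=x_j$ if $d_j=1$ and $\phi_d(x_j)=1$ if $d_j=0$; for an ideal $H\subseteq R$ and $g\in R$ write $H_d=\phi_d(H)$ and $g_d=\phi_d(g)$. Suppose that $d\in\{0,1\}^n$ is such that for some $\beta'\in\{0,1\}^n$ $$(I^{[p]}:_R I)_d \;=\; I_d^{[p]}+\big((x^{\beta'})_d^{\,p-1}\big).$$ (If $(I^{[p]}:_R I)=I^{[p]}+J_p+((x^{\beta})^{p-1})$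 for an ideal $J_p$ and some $\beta\in\{0,1\}^n$, the left-hand side is $I_d^{[p]}+(J_p)_d+((x^{\beta})_d^{\,p-1})$.) Then the open set $D(x^{d^+})\subseteq\operatorname{Spec}(\widehat S)$ of the primes not containing the image of $x^{d^+}$ is contained in $$U=\{Q\in\operatorname{Spec}(\widehat S) : \mathcal F(E_{\widehat{S_Q}})\text{ is a finitely generated } \widehat{S_Q}\text{-algebra}\}.$$ Here $\widehat{S_Q}$ is the completion of the local ring $\widehat S_Q$ at its maximal ideal; $E_A$ is the injective hull of the residue field of a local ring $A$; $\mathcal F(E_A)=\bigoplus_{e\ge 0}\mathcal F^e(E_A)$, where $\mathcal F^e(E_A)$ is the group of additive maps $\varphi:E_A\to E_A$ with $\varphi(rx)=r^{p^e}\varphi(x)$ for all $r\in A$, $x\in E_A$, with multiplication given by composition $\mathcal F^e\times\mathcal F^{e'}\to\mathcal F^{e+e'}$; and it is called a finitely generated $A$-algebra if it is generated as a ring by the multiplications by elements of $A$ (in degree $0$) together with finitely many further elements. -/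

import Mathlib

open scoped DirectSum

/-! ### Frobenius powers and square-free monomial ideals -/

/-- The Frobenius power `I^{[p^e]}`: the ideal generated by the `p^e`-th powers of the elements
of `I`. -/
def frobeniusPower {A : Type*} [CommRing A] (p e : ℕ) (I : Ideal A) : Ideal A :=
  Ideal.span {b | ∃ a ∈ I, b = a ^ p ^ e}

/-- The colon ideal `(I^{[p^e]} : I)`. -/
def frobeniusColon {A : Type*} [CommRing A] (p e : ℕ) (I : Ideal A) : Ideal A :=
  (frobeniusPower p e I).colon (I : Set A)

/-- The square-free monomial `x^d = ∏_{d_i = 1} x_i`, where the vector `d ∈ {0,1}^n` is given by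
its support, a subset of `{1, …, n}`. -/
noncomputable def sqfreeMonomial (k : Type*) [CommRing k] {n : ℕ} (d : Finset (Fin n)) :
    MvPolynomial (Fin n) k :=
  ∏ i ∈ d, MvPolynomial.X i

/-- Face ideals: the ideals generated by square-free monomials. -/
def IsFaceIdeal {k : Type*} [CommRing k] {n : ℕ} (I : Ideal (MvPolynomial (Fin n) k)) : Prop :=
  ∃ G : Set (Finset (Fin n)), I = Ideal.span (sqfreeMonomial k '' G)

/-- The `k`-algebra homomorphism `φ_d : k[x_1, …, x_n] → k[x_j : j ∈ supp d]` that fixes `x_j` for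
`j ∈ supp d` and sends the other variables to `1`. -/
noncomputable def setOne (k : Type*) [CommRing k] {n : ℕ} (d : Finset (Fin n)) :
    MvPolynomial (Fin n) k →ₐ[k] MvPolynomial {i : Fin n // i ∈ d} k :=
  MvPolynomial.aeval fun i => if h : i ∈ d then MvPolynomial.X ⟨i, h⟩ else 1

/-- `φ_d` is surjective, so that the image of an ideal under it is an ideal and is the ideal
`Ideal.map (setOne k d)` generated by it. -/
theorem setOne_surjective (k : Type*) [CommRing k] {n : ℕ} (d : Finset (Fin n)) :
    Function.Surjective (setOne k d) := by
  intro f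
  refine ⟨MvPolynomial.rename Subtype.val f, ?_⟩
  rw [setOne, MvPolynomial.aeval_rename]
  have h : ((fun i => if h : i ∈ d then MvPolynomial.X ⟨i, h⟩ else 1 :
      Fin n → MvPolynomial {i : Fin n // i ∈ d} k) ∘ Subtype.val) = MvPolynomial.X := by
    funext i
    simp [i.2]
  rw [h, MvPolynomial.aeval_X_left_apply]

/-! ### Injective hulls -/

section InjectiveHull

universe u

/-- `ι : M → E` exhibits `E` as an injective hull of `M`: `E` is an injective module, `ι` is
injective and every nonzero submodule of `E` meets the image of `M` nontrivially. -/
structure IsInjectiveHull {A : Type u} [CommRing A] {M E : Type u} [AddCommGroup M] [Module A M]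
    [AddCommGroup E] [Module A E] (ι : M →ₗ[A] E) : Prop where
  injective_module : Module.Injective A E
  injective : Function.Injective ι
  essential : ∀ N : Submodule A E, N ≠ ⊥ → N ⊓ LinearMap.range ι ≠ ⊥

/-- Every module has an injective hull in its own universe. -/
theorem exists_isInjectiveHull (A : Type u) [CommRing A] (M : Type u) [AddCommGroup M]
    [Module A M] :
    ∃ (E : Type u) (_ : AddCommGroup E) (_ : Module A E) (ι : M →ₗ[A] E), IsInjectiveHull ι := by
  obtain ⟨F, _, _, hF, j, hj⟩ : ∃ (F : Type u) (_ : AddCommGroup F) (_ : Module A F)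
      (_ : Module.Injective A F) (j : M →ₗ[A] F), Function.Injective j := by
    obtain ⟨P⟩ := CategoryTheory.EnoughInjectives.presentation (ModuleCat.of A M)
    refine ⟨P.J, inferInstance, inferInstance, ?_, P.f.hom, ?_⟩
    · exact (Module.injective_iff_injective_object A P.J).mpr
        (by simpa using P.injective)
    · exact (ModuleCat.mono_iff_injective P.f).mp P.mono
  let S : Set (Submodule A F) := {E | LinearMap.range j ≤ E ∧
    ∀ N : Submodule A F, N ≤ E → N ≠ ⊥ → N ⊓ LinearMap.range j ≠ ⊥}
  have hel : ∀ E : Submodule A F, E ∈ S ↔ LinearMap.range j ≤ E ∧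
      ∀ x ∈ E, x ≠ 0 → ∃ a : A, a • x ≠ 0 ∧ a • x ∈ LinearMap.range j := by
    intro E
    refine and_congr_right fun _ => ⟨fun h x hx hx0 => ?_, fun h N hN hN0 => ?_⟩
    · have := h (A ∙ x) (by simpa using hx) (by simpa using hx0)
      obtain ⟨y, hy, hy0⟩ := Submodule.exists_mem_ne_zero_of_ne_bot this
      obtain ⟨a, rfl⟩ := Submodule.mem_span_singleton.mp hy.1
      exact ⟨a, hy0, hy.2⟩
    · obtain ⟨x, hx, hx0⟩ := Submodule.exists_mem_ne_zero_of_ne_bot hN0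
      obtain ⟨a, ha, ha'⟩ := h x (hN hx) hx0
      exact (Submodule.ne_bot_iff _).mpr ⟨a • x, ⟨N.smul_mem a hx, ha'⟩, ha⟩
  obtain ⟨E, -, hE⟩ : ∃ E, LinearMap.range j ≤ E ∧ Maximal (· ∈ S) E := by
    refine zorn_le_nonempty₀ S (fun c hc hchain y hy => ?_) (LinearMap.range j) ?_
    · refine ⟨sSup c, (hel _).mpr ⟨(hc hy).1.trans (le_sSup hy), fun x hx hx0 => ?_⟩,
        fun z hz => le_sSup hz⟩
      obtain ⟨N, hN, hxN⟩ := (Submodule.mem_sSup_of_directed ⟨y, hy⟩ hchain.directedOn).mp hx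
      exact ((hel N).mp (hc hN)).2 x hxN hx0
    · refine ⟨le_rfl, fun N hN hN0 => by rwa [inf_eq_left.mpr hN]⟩
  obtain ⟨C, -, hC⟩ : ∃ C, (⊥ : Submodule A F) ≤ C ∧ Maximal (· ∈ {C | Disjoint C E}) C := by
    refine zorn_le_nonempty₀ {C : Submodule A F | Disjoint C E} (fun c hc hchain y hy => ?_) ⊥ ?_
    · refine ⟨sSup c, ?_, fun z hz => le_sSup hz⟩
      refine Submodule.disjoint_def.mpr fun x hx hxE => ?_
      obtain ⟨N, hN, hxN⟩ := (Submodule.mem_sSup_of_directed ⟨y, hy⟩ hchain.directedOn).mp hx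
      exact Submodule.disjoint_def.mp (hc hN) x hxN hxE
    · exact disjoint_bot_left
  -- the inclusion of `E` extends to `F ⧸ C`
  have hqi : Function.Injective (C.mkQ ∘ₗ E.subtype) := by
    rw [← LinearMap.ker_eq_bot, LinearMap.ker_eq_bot']
    intro x hx
    have hxC : (x : F) ∈ C := by simpa using hx
    exact Subtype.ext (Submodule.disjoint_def.mp hC.prop x hxC x.2)
  obtain ⟨g, hg⟩ := hF.out (C.mkQ ∘ₗ E.subtype) hqi E.subtype
  have hgE : ∀ x ∈ E, g (C.mkQ x) = x := fun x hx => hg ⟨x, hx⟩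
  -- `F ⧸ C` is essential over `E`
  have hess : ∀ y : F, y ∉ C → ∃ a : A, ∃ c ∈ C, a • y + c ∈ E ∧ a • y + c ≠ 0 := by
    intro y hy
    by_contra! hcon
    have hle : C ⊔ (A ∙ y) ≤ C := by
      refine hC.le_of_ge ?_ le_sup_left
      refine Submodule.disjoint_def.mpr fun x hx hxE => ?_
      obtain ⟨c, hc, z, hz, rfl⟩ := Submodule.mem_sup.mp hx
      obtain ⟨a, rfl⟩ := Submodule.mem_span_singleton.mp hz
      rw [add_comm] at hxE ⊢
      exact hcon a c hc hxE
    exact hy (hle (Submodule.mem_sup_right (Submodule.mem_span_singleton_self y)))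
  have hrange : LinearMap.range g ∈ S := by
    refine (hel _).mpr ⟨fun x hx => ⟨C.mkQ x, hgE x (hE.prop.1 hx)⟩, ?_⟩
    rintro _ ⟨z, rfl⟩ hx0
    obtain ⟨y, rfl⟩ := C.mkQ_surjective z
    have hy : y ∉ C := fun h => hx0 (by rw [(LinearMap.mem_ker (f := C.mkQ)).mp
      (by simpa using h), map_zero])
    obtain ⟨a, c, hc, haE, ha0⟩ := hess y hy
    obtain ⟨b, hb0, hb⟩ := ((hel E).mp hE.prop).2 _ haE ha0
    have hgy : g (C.mkQ (a • y + c)) = a • g (C.mkQ y) := by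
      rw [map_add C.mkQ, map_smul, show C.mkQ c = 0 by simpa using hc, add_zero,
        map_smul]
    rw [hgE _ haE] at hgy
    exact ⟨b * a, by rwa [mul_smul, ← hgy], by rwa [mul_smul, ← hgy]⟩
  have hgr : ∀ z, g z ∈ E := fun z =>
    hE.le_of_ge hrange (fun x hx => ⟨C.mkQ x, hgE x hx⟩) ⟨z, rfl⟩
  refine ⟨E, inferInstance, inferInstance, j.codRestrict E fun m => hE.prop.1 ⟨m, rfl⟩,
    ⟨⟨fun X Y _ _ _ _ f hf q => ?_⟩, fun a b hab => hj (congrArg Subtype.val hab), ?_⟩⟩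
  · obtain ⟨h, hh⟩ := hF.out f hf (E.subtype ∘ₗ q)
    refine ⟨(g ∘ₗ C.mkQ ∘ₗ h).codRestrict E fun y => hgr _, fun x => Subtype.ext ?_⟩
    change g (C.mkQ (h (f x))) = q x
    rw [hh]
    exact hgE _ (q x).2
  · intro N hN
    obtain ⟨x, hx, hx0⟩ := Submodule.exists_mem_ne_zero_of_ne_bot hN
    obtain ⟨a, ha0, m, hm⟩ := ((hel E).mp hE.prop).2 x x.2 (by simpa using hx0)
    refine (Submodule.ne_bot_iff _).mpr ⟨a • x, ⟨N.smul_mem a hx, m, Subtype.ext hm⟩, fun h => ?_⟩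
    exact ha0 (by simpa using congrArg Subtype.val h)

end InjectiveHull

/-! ### Frobenius algebras -/

section FrobeniusAlgebra

variable (p : ℕ) (A : Type*) [CommRing A] (E : Type*) [AddCommGroup E] [Module A E]

/-- `𝓕^e(E)`: the additive maps `φ : E → E` with `φ (r x) = r ^ (p ^ e) φ x`. -/
def frobeniusHom (e : ℕ) : AddSubgroup (AddMonoid.End E) where
  carrier := {φ | ∀ (r : A) (x : E), φ (r • x) = r ^ p ^ e • φ x}
  add_mem' := by
    intro φ ψ hφ hψ r x
    change φ (r • x) + ψ (r • x) = r ^ p ^ e • (φ x + ψ x)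
    rw [hφ, hψ, smul_add]
  zero_mem' := by
    intro r x
    exact (smul_zero (r ^ p ^ e)).symm
  neg_mem' := by
    intro φ hφ r x
    change -φ (r • x) = r ^ p ^ e • -φ x
    rw [hφ, smul_neg]

instance frobeniusHom_gradedMonoid : SetLike.GradedMonoid (frobeniusHom p A E) where
  one_mem := by
    intro r x
    simp
  mul_mem := by
    intro i j φ ψ hφ hψ r x
    rw [AddMonoid.End.coe_mul, Function.comp_apply, Function.comp_apply, hψ r x, hφ, ← pow_mul,
      ← pow_add, add_comm j i]

/-- The Frobenius algebra `𝓕(E) = ⨁_e 𝓕^e(E)`. It is an external direct sum; its (in general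
noncommutative) multiplication is induced by composition `𝓕^i(E) × 𝓕^j(E) → 𝓕^{i+j}(E)`. -/
abbrev FrobeniusAlgebra : Type _ := ⨁ e : ℕ, frobeniusHom p A E e

/-- The canonical ring homomorphism `A → 𝓕(E)`, sending `r` to the multiplication by `r`, in
degree `0`. -/
def frobeniusAlgebraMap : A →+* FrobeniusAlgebra p A E :=
  (DirectSum.ofZeroRingHom fun e => frobeniusHom p A E e).comp
    { toFun := fun r => ⟨Module.toAddMonoidEnd A E r, fun s x => by
        rw [pow_zero, pow_one]
        exact smul_comm r s x⟩
      map_one' := Subtype.ext (map_one _)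
      map_mul' := fun r s => Subtype.ext (map_mul _ r s)
      map_zero' := Subtype.ext (map_zero _)
      map_add' := fun r s => Subtype.ext (map_add _ r s) }

/-- `𝓕(E)` is a finitely generated `A`-algebra: it is generated, as a ring, by the image of `A`
and finitely many further elements. (`A` need not be central in `𝓕(E)`.) -/
def FrobeniusAlgebraFG : Prop :=
  ∃ T : Finset (FrobeniusAlgebra p A E),
    Subring.closure (Set.range (frobeniusAlgebraMap p A E) ∪ (T : Set _)) = ⊤

end FrobeniusAlgebra

/-! ### The finitely generated locus -/

section Locus

universe u

/-- The completion of the localization `B_Q` with respect to its maximal ideal. -/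
abbrev CompletedLocalization (B : Type u) [CommRing B] (Q : PrimeSpectrum B) : Type u :=
  AdicCompletion (IsLocalRing.maximalIdeal (Localization.AtPrime Q.asIdeal))
    (Localization.AtPrime Q.asIdeal)

/-- For a local ring `A`, the Frobenius algebra of the injective hull `E_A` of the residue field
of `A` is a finitely generated `A`-algebra. An injective hull exists (`exists_isInjectiveHull`)
and is unique up to isomorphism. -/
def HasFGFrobeniusAlgebra (p : ℕ) (A : Type u) [CommRing A] [IsLocalRing A] : Prop :=
  ∀ (E : Type u) [AddCommGroup E] [Module A E] (ι : IsLocalRing.ResidueField A →ₗ[A] E),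
    IsInjectiveHull ι → FrobeniusAlgebraFG p A E

/-- The finitely generated locus of a Noetherian ring `B`: the primes `Q` such that `𝓕(E_A)` is a
finitely generated `A`-algebra for the completion `A` of `B_Q`. -/
def fgLocus (p : ℕ) (B : Type u) [CommRing B] [IsNoetherianRing B] : Set (PrimeSpectrum B) :=
  {Q | HasFGFrobeniusAlgebra p (CompletedLocalization B Q)}

/-- The complete ring `Ŝ = k[[x_1, …, x_n]] / I k[[x_1, …, x_n]]`, the completion of
`S = k[x_1, …, x_n] / I` at the ideal generated by the variables. -/
abbrev CompletedFaceRing {k : Type u} [Field k] {n : ℕ} (I : Ideal (MvPolynomial (Fin n) k)) :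
    Type u :=
  MvPowerSeries (Fin n) k ⧸ I.map (MvPolynomial.coeToMvPowerSeries.ringHom (R := k))

/-- The canonical homomorphism `k[x_1, …, x_n] → Ŝ`. -/
noncomputable def toCompletedFaceRing {k : Type u} [Field k] {n : ℕ}
    (I : Ideal (MvPolynomial (Fin n) k)) : MvPolynomial (Fin n) k →+* CompletedFaceRing I :=
  (Ideal.Quotient.mk _).comp (MvPolynomial.coeToMvPowerSeries.ringHom (R := k))

end Locus

-- Let `P` be the preimage of `Q` in `k[[x]]`, `W = k[[x]]_P` and `J = I W`, so that `Ŝ_Q = W / J`;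
-- let `A` be the completion of `W / J`. Since `Q` lies in `D(x^{d⁺})`, the variables outside `d`
-- are units of `W`, and only the parts of monomials inside `d` matter. The argument shows that
-- `𝓕(E_A)` is generated over degree 0 by a single element of degree 1.
--
-- The combinatorial half rests on one remark: whether `x^a` lies in `(I^[q] : I)` depends on `a`
-- only through the two sets `{a_i ≥ q}` and `{a_i ≥ q - 1}`. The hypothesis for `p` therefore
-- carries over to every `q = p^e`. With `u = x^{β' ∩ d}` it gives `(J^[q] : J) ⊆ J^[q] + (u^{q-1})`
-- and `u^{p-1} ∈ (J^[p] : J)` (`subset_or_subset_of_colon`, `frobeniusColon_le_sup_span`,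
-- `pow_mem_frobeniusColon`).
--
-- The algebraic half is a form of Fedder's description of `p^e`-linear maps. The hull `E_A` is the
-- `J`-torsion of the top local cohomology `D` of `W` (`exists_embedding`). On elements of bounded
-- torsion every `p^e`-linear endomorphism is `t F^e`, where `t` is close to an element of `(J^[q] :
-- J)`; since `J^[q]` kills `F^e` of the `J`-torsion, `t` may be taken to be a multiple of `u^{q-1}`
-- (`exists_eq_smul_frobenius`, `exists_eq_smul_mul_frobenius`). The multipliers, suitably
-- corrected, converge in `A` (`exists_eq_smul`), and `u^{q-1} F^e = (u^{p-1} F)^e`, so the degree 1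
-- element `u^{p-1} F` generates (`frobeniusAlgebraFG`).
--
-- What is needed of `W` is derived from the flatness of its Frobenius, which holds for `k[[x]]`
-- even if `k` is infinite over its `p`-th powers, and passes to localizations. Flatness makes
-- minimal generators of the maximal ideal behave like a regular sequence (`lechIndependent_pow`),
-- which turns `D` into an injective hull of the residue field, and it makes Frobenius powers
-- commute with intersections and colons.

universe u

/-! ### Equational flatness of the Frobenius -/

/-- The equational criterion for flatness of the map `x ↦ x ^ q`: every linear relation between
`q`-th powers is a combination of `q`-th powers of linear relations. -/
def EqFlatPow (W : Type*) [CommRing W] (q : ℕ) : Prop :=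
  ∀ ⦃m : ℕ⦄ (a w : Fin m → W), ∑ i, w i * a i ^ q = 0 →
    ∃ (l : ℕ) (c : Fin l → W) (b : Fin l → Fin m → W),
      (∀ i, w i = ∑ j, c j * b j i ^ q) ∧ ∀ j, ∑ i, b j i * a i = 0

theorem EqFlatPow.exists_of_fintype {W : Type*} [CommRing W] {q : ℕ} (h : EqFlatPow W q)
    {ι : Type*} [Fintype ι] (a w : ι → W) (hw : ∑ i, w i * a i ^ q = 0) :
    ∃ (l : ℕ) (c : Fin l → W) (b : Fin l → ι → W),
      (∀ i, w i = ∑ j, c j * b j i ^ q) ∧ ∀ j, ∑ i, b j i * a i = 0 := by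
  let e := Fintype.equivFin ι
  obtain ⟨l, c, b, h1, h2⟩ := h (a ∘ e.symm) (w ∘ e.symm) (by
    rw [← hw]
    exact Equiv.sum_comp e.symm (fun i => w i * a i ^ q))
  refine ⟨l, c, fun j i => b j (e i), fun i => ?_, fun j => ?_⟩
  · simpa using h1 (e i)
  · rw [← h2 j, ← Equiv.sum_comp e]
    simp

/-- A field of characteristic `p` has a basis over its subfield of `p ^ e`-th powers; `ρ i` is the
`p ^ e`-th root of the `i`-th coordinate. -/
theorem exists_frobenius_coordinates (k : Type u) [Field k] (p : ℕ) [Fact p.Prime] [CharP k p]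
    (e : ℕ) : ∃ (ι : Type u) (ρ : ι → k →+ k), (∀ i r c, ρ i (r ^ p ^ e * c) = r * ρ i c) ∧
      (∀ c, {i | ρ i c ≠ 0}.Finite) ∧ (∀ c, (∀ i, ρ i c = 0) → c = 0) ∧
      ∀ h : ι → k, {i | h i ≠ 0}.Finite → ∃ c, ∀ i, ρ i c = h i := by
  let K := (iterateFrobenius k p e).fieldRange
  let φ : k ≃+* K := RingEquiv.ofBijective (iterateFrobenius k p e).rangeRestrictField
    ⟨RingHom.injective _, (iterateFrobenius k p e).rangeRestrictField_bijective.2⟩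
  let B := Module.Basis.ofVectorSpace K k
  have hφ : ∀ r, ((φ r : K) : k) = r ^ p ^ e := fun r => by
    rw [← iterateFrobenius_def]; rfl
  refine ⟨_, fun i => (φ.symm : K →+ k).comp ((B.coord i : k →ₗ[K] K) : k →+ K), ?_, ?_, ?_, ?_⟩
  · intro i r c
    have : r ^ p ^ e * c = φ r • c := by rw [← hφ]; rfl
    rw [this]
    simp
  · intro c
    refine (B.repr c).hasFiniteSupport.subset fun i hi => ?_
    simpa using hi
  · intro c hc
    have : B.repr c = 0 := by
      ext i
      have := hc i
      simpa using this
    simpa using this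
  · intro h hf
    refine ⟨B.repr.symm (Finsupp.ofSupportFinite (fun i => φ (h i)) (hf.subset fun i hi => ?_)),
      fun i => ?_⟩
    · intro h0
      exact hi (by simp [h0])
    · simp [Finsupp.ofSupportFinite_coe]

/-! ### Power series: monomial ideals, orders, and flatness of the Frobenius -/

namespace MvPowerSeries

variable {n : ℕ} {k : Type u}

theorem coeff_smul_pow_char [Field k] (p : ℕ) [Fact p.Prime] [CharP k p] (e : ℕ)
    (f : MvPowerSeries (Fin n) k) (γ : Fin n →₀ ℕ) :
    coeff (p ^ e • γ) (f ^ p ^ e) = coeff γ f ^ p ^ e := by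
  rw [← map_iterateFrobenius_expand p (Fact.out : p.Prime).ne_zero f e, coeff_map,
    coeff_expand_smul, iterateFrobenius_def]

theorem coeff_pow_char_of_not_dvd [Field k] (p : ℕ) [Fact p.Prime] [CharP k p] (e : ℕ)
    (f : MvPowerSeries (Fin n) k) (γ : Fin n →₀ ℕ) {i : Fin n} (h : ¬ p ^ e ∣ γ i) :
    coeff γ (f ^ p ^ e) = 0 := by
  rw [← map_iterateFrobenius_expand p (Fact.out : p.Prime).ne_zero f e, coeff_map,
    coeff_expand_of_not_dvd _ _ _ h, map_zero]

/-- A power series all of whose exponents are bounded below by one of finitely many exponents is in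
the ideal generated by the corresponding monomials. -/
theorem mem_span_monomial [Field k] (F : Finset (Fin n →₀ ℕ)) (f : MvPowerSeries (Fin n) k)
    (hf : ∀ d, coeff d f ≠ 0 → ∃ a ∈ F, a ≤ d) :
    f ∈ Ideal.span ((fun a => monomial a (1 : k)) '' (F : Set (Fin n →₀ ℕ))) := by
  classical
  choose! s hsF hs using hf
  -- Each exponent `d` of `f` is charged to the single monomial `s d ≤ d`; `g a` collects the
  -- coefficients charged to `a`, so the terms of `f` are partitioned.
  let g : (Fin n →₀ ℕ) → MvPowerSeries (Fin n) k := fun a d =>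
    if s (d + a) = a then coeff (d + a) f else 0
  have : f = ∑ a ∈ F, g a * monomial a 1 := by
    ext d
    rw [map_sum]
    by_cases hd : coeff d f = 0
    · rw [hd, Finset.sum_eq_zero]
      intro a _
      rw [coeff_mul_monomial]
      split_ifs with h
      · change (if s (d - a + a) = a then coeff (d - a + a) f else 0) * 1 = 0
        rw [tsub_add_cancel_of_le h, hd]
        simp
      · rfl
    · rw [Finset.sum_eq_single (s d)]
      · rw [coeff_mul_monomial, if_pos (hs d hd)]
        change _ = (if s (d - s d + s d) = s d then coeff (d - s d + s d) f else 0) * 1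
        rw [tsub_add_cancel_of_le (hs d hd), if_pos rfl, mul_one]
      · intro a _ hne
        rw [coeff_mul_monomial]
        split_ifs with h
        · change (if s (d - a + a) = a then coeff (d - a + a) f else 0) * 1 = 0
          rw [tsub_add_cancel_of_le h, if_neg (Ne.symm hne), zero_mul]
        · rfl
      · intro h
        exact absurd (hsF d hd) h
  rw [this]
  exact Ideal.sum_mem _ fun a ha => Ideal.mul_mem_left _ _ (Ideal.subset_span ⟨a, ha, rfl⟩)

/-- The exponents of the elements of an ideal generated by monomials. -/
theorem exists_le_of_mem_span_monomial [Field k] {F : Set (Fin n →₀ ℕ)}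
    {f : MvPowerSeries (Fin n) k} (hf : f ∈ Ideal.span ((fun a => monomial a (1 : k)) '' F))
    {d : Fin n →₀ ℕ} (hd : coeff d f ≠ 0) : ∃ a ∈ F, a ≤ d := by
  classical
  induction hf using Submodule.span_induction generalizing d with
  | mem x hx =>
    obtain ⟨a, ha, rfl⟩ := hx
    refine ⟨a, ha, ?_⟩
    simp only [coeff_monomial] at hd
    split_ifs at hd with h
    · exact h.ge
    · simp at hd
  | zero => simp at hd
  | add x y _ _ hx hy =>
    by_cases h : coeff d x = 0
    · exact hy (d := d) (by simpa [h] using hd)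
    · exact hx h
  | smul r x _ hx =>
    rw [smul_eq_mul, coeff_mul] at hd
    obtain ⟨⟨u, v⟩, huv, h⟩ := Finset.exists_ne_zero_of_sum_ne_zero hd
    obtain ⟨a, ha, hav⟩ := hx (right_ne_zero_of_mul h)
    refine ⟨a, ha, hav.trans ?_⟩
    rw [← Finset.HasAntidiagonal.mem_antidiagonal.mp huv]
    exact le_add_self

theorem monomial_one_mem_span_X_pow [Field k] (a : Fin n →₀ ℕ) :
    (monomial a (1 : k)) ∈ Ideal.span (Set.range (X : Fin n → MvPowerSeries (Fin n) k)) ^ a.degree := by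
  induction a using Finsupp.induction_linear with
  | zero => simp
  | add f g hf hg =>
    rw [map_add, pow_add, ← one_mul (1 : k), ← monomial_mul_monomial]
    exact Ideal.mul_mem_mul hf hg
  | single i r =>
    rw [Finsupp.degree_single, ← X_pow_eq]
    exact Ideal.pow_mem_pow (Ideal.subset_span (Set.mem_range_self i)) r

/-- Translates the adic order used by Artin–Rees into vanishing of coefficients. The backward
direction works because there are only finitely many monomials of degree `N`. -/
theorem mem_span_X_pow_iff [Field k] (N : ℕ) (f : MvPowerSeries (Fin n) k) :
    f ∈ Ideal.span (Set.range (X : Fin n → MvPowerSeries (Fin n) k)) ^ N ↔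
      ∀ d : Fin n →₀ ℕ, d.degree < N → coeff d f = 0 := by
  constructor
  · intro hf d hd
    have hle : ∀ N, Ideal.span (Set.range (X : Fin n → MvPowerSeries (Fin n) k)) ^ N ≤
        Ideal.span ((fun a => monomial a (1 : k)) '' {a : Fin n →₀ ℕ | a.degree = N}) := by
      intro N
      induction N with
      | zero =>
        have h1 : (1 : MvPowerSeries (Fin n) k) ∈
            Ideal.span ((fun a => monomial a (1 : k)) '' {a : Fin n →₀ ℕ | a.degree = 0}) :=
          Ideal.subset_span ⟨0, by simp, monomial_zero_one⟩
        exact fun f _ => (Ideal.eq_top_iff_one _).mpr h1 ▸ trivial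
      | succ N ih =>
        rw [pow_succ]
        refine (Ideal.mul_mono_left ih).trans ?_
        rw [Ideal.span_mul_span']
        refine Ideal.span_le.mpr ?_
        rintro _ hx
        obtain ⟨_, ⟨a, ha, rfl⟩, _, ⟨i, rfl⟩, rfl⟩ := Set.mem_mul.mp hx
        refine Submodule.subset_span ⟨a + Finsupp.single i 1, ?_, ?_⟩
        · have : a.degree = N := ha
          simp [this]
        · change monomial _ _ = monomial a 1 * X i
          rw [X_def, monomial_mul_monomial, one_mul]
    by_contra h
    obtain ⟨a, ha, had⟩ := exists_le_of_mem_span_monomial (hle N hf) h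
    have := Finsupp.degree_mono had
    have ha' : a.degree = N := ha
    omega
  · intro hf
    have hfin := Finsupp.finite_of_degree_eq (σ := Fin n) N
    refine (Ideal.span_le (I := Ideal.span _ ^ N)).mpr ?_ (mem_span_monomial hfin.toFinset f fun d hd => ?_)
    · rintro _ ⟨a, ha, rfl⟩
      have ha' : a.degree = N := by simpa using ha
      rw [← ha']
      exact monomial_one_mem_span_X_pow a
    · have hN : N ≤ d.degree := by
        by_contra h
        exact hd (hf d (by omega))
      obtain ⟨a, had, ha⟩ := Finsupp.exists_le_degree_eq d N hN
      exact ⟨a, by simpa using ha, had⟩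

/-- Coordinates of power series with respect to the `p ^ e`-th powers of power series. -/
theorem exists_frobenius_coordinates [Field k] (p : ℕ) [Fact p.Prime] [CharP k p] (e : ℕ) :
    ∃ (ι : Type u) (ρ : ι → MvPowerSeries (Fin n) k →+ MvPowerSeries (Fin n) k),
      (∀ i r c, ρ i (r ^ p ^ e * c) = r * ρ i c) ∧
      (∀ c γ, {i | coeff γ (ρ i c) ≠ 0}.Finite) ∧ (∀ c, (∀ i, ρ i c = 0) → c = 0) ∧
      ∀ h : ι → MvPowerSeries (Fin n) k, (∀ γ, {i | coeff γ (h i) ≠ 0}.Finite) →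
        ∃ c, ∀ i, ρ i c = h i := by
  obtain ⟨B, ρ, h1, h2, h3, h4⟩ := _root_.exists_frobenius_coordinates k p e
  have hq : 0 < p ^ e := pow_pos (Fact.out : p.Prime).pos e
  let emb : (Fin n → Fin (p ^ e)) → Fin n →₀ ℕ := fun α =>
    Finsupp.equivFunOnFinite.symm fun i => (α i : ℕ)
  have hemb : ∀ α i, emb α i = α i := fun α i => rfl
  -- Coordinates with respect to the products `b_β x^α`, with `b_β` a basis of `k` over its `q`-th
  -- powers and `0 ≤ α_i < q`. If the basis is infinite, only coefficientwise finiteness of the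
  -- coordinates survives.
  let T : B × (Fin n → Fin (p ^ e)) → MvPowerSeries (Fin n) k →+ MvPowerSeries (Fin n) k :=
    fun i =>
      { toFun := fun g γ => ρ i.1 (coeff (p ^ e • γ + emb i.2) g)
        map_zero' := by funext γ; simp; rfl
        map_add' := fun f g => by
          funext γ
          simp only [map_add]
          rfl }
  have hT : ∀ i g γ, coeff γ (T i g) = ρ i.1 (coeff (p ^ e • γ + emb i.2) g) :=
    fun i g γ => rfl
  have hdecomp : ∀ δ : Fin n →₀ ℕ, ∃ γ α, δ = p ^ e • γ + emb α := by
    intro δ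
    refine ⟨Finsupp.equivFunOnFinite.symm fun i => δ i / p ^ e,
      fun i => ⟨δ i % p ^ e, Nat.mod_lt _ hq⟩, ?_⟩
    ext i
    simp [hemb, Nat.div_add_mod]
  have huniq : ∀ γ α γ' α', p ^ e • γ + emb α = p ^ e • γ' + emb α' → γ = γ' ∧ α = α' := by
    intro γ α γ' α' h
    have hi : ∀ i, p ^ e * γ i + α i = p ^ e * γ' i + α' i := fun i => by
      simpa [hemb] using DFunLike.congr_fun h i
    constructor
    · ext i
      have := congrArg (· / p ^ e) (hi i)
      simpa [Nat.mul_add_div hq, Nat.div_eq_of_lt (α i).2, Nat.div_eq_of_lt (α' i).2] using this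
    · funext i
      have := congrArg (· % p ^ e) (hi i)
      exact Fin.ext (by
        simpa [Nat.mul_add_mod, Nat.mod_eq_of_lt (α i).2, Nat.mod_eq_of_lt (α' i).2] using this)
  refine ⟨B × (Fin n → Fin (p ^ e)), T, ?_, ?_, ?_, ?_⟩
  · rintro ⟨β, α⟩ f g
    ext γ
    classical
    rw [hT, coeff_mul, coeff_mul, map_sum]
    symm
    -- In the coefficient of `f ^ q * g` at `qγ + α` only the splittings whose first exponent is
    -- divisible by `q` contribute. Since `α_i < q`, these come from the splittings of `γ`.
    refine Finset.sum_of_injOn (fun x => (p ^ e • x.1, p ^ e • x.2 + emb α)) ?_ ?_ ?_ ?_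
    · rintro ⟨a, b⟩ _ ⟨a', b'⟩ _ h
      simp only [Prod.mk.injEq, add_left_inj] at h
      have hinj : Function.Injective fun a : Fin n →₀ ℕ => p ^ e • a :=
        fun a b hab => (huniq a (fun _ => ⟨0, hq⟩) b (fun _ => ⟨0, hq⟩)
          (congrArg (· + _) hab)).1
      exact Prod.ext (hinj h.1) (hinj h.2)
    · rintro ⟨a, b⟩ hab
      have := Finset.HasAntidiagonal.mem_antidiagonal.mp hab
      refine Finset.HasAntidiagonal.mem_antidiagonal.mpr ?_
      simp only at this ⊢
      rw [← this, smul_add, add_assoc]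
    · rintro ⟨a, b⟩ hab hne
      have hab := Finset.HasAntidiagonal.mem_antidiagonal.mp hab
      simp only at hab
      by_cases hdvd : ∀ i, p ^ e ∣ a i
      · exfalso
        choose a' ha' using hdvd
        have haa : p ^ e • Finsupp.equivFunOnFinite.symm a' = a := by
          ext i
          simp [ha']
        have hle : Finsupp.equivFunOnFinite.symm a' ≤ γ := by
          intro i
          have h1 : a i + b i = p ^ e * γ i + α i := by
            simpa [hemb] using DFunLike.congr_fun hab i
          have h2 : p ^ e * a' i < p ^ e * (γ i + 1) := by
            rw [← ha' i, mul_add, mul_one]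
            have := (α i).2
            omega
          exact Nat.lt_succ_iff.mp (lt_of_mul_lt_mul_left h2 hq.le)
        refine hne ⟨(Finsupp.equivFunOnFinite.symm a', γ - Finsupp.equivFunOnFinite.symm a'), ?_, ?_⟩
        · refine Finset.mem_coe.mpr (Finset.HasAntidiagonal.mem_antidiagonal.mpr ?_)
          exact add_tsub_cancel_of_le hle
        · refine Prod.ext haa ?_
          refine add_left_cancel (a := a) ?_
          rw [hab]
          change a + (p ^ e • (γ - Finsupp.equivFunOnFinite.symm a') + emb α) = _
          rw [← add_assoc]
          congr 1
          conv_lhs => rw [← haa]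
          rw [← smul_add, add_tsub_cancel_of_le hle]
      · push Not at hdvd
        obtain ⟨i, hi⟩ := hdvd
        simp [coeff_pow_char_of_not_dvd p e f a hi]
    · rintro ⟨a, b⟩ hab
      simp only
      rw [coeff_smul_pow_char, h1, hT]
  · intro g γ
    have : {i : B × (Fin n → Fin (p ^ e)) | coeff γ (T i g) ≠ 0} ⊆
        ⋃ α : Fin n → Fin (p ^ e), (fun β => (β, α)) ''
          {β | ρ β (coeff (p ^ e • γ + emb α) g) ≠ 0} := by
      rintro ⟨β, α⟩ h
      exact Set.mem_iUnion.mpr ⟨α, β, h, rfl⟩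
    exact (Set.finite_iUnion fun α => (h2 _).image _).subset this
  · intro g hg
    ext δ
    obtain ⟨γ, α, rfl⟩ := hdecomp δ
    refine h3 _ fun β => ?_
    rw [← hT (β, α), hg, map_zero]
  · intro h hfin
    choose G A hGA using hdecomp
    have : ∀ δ, ∃ c, ∀ β, ρ β c = coeff (G δ) (h (β, A δ)) := fun δ =>
      h4 (fun β => coeff (G δ) (h (β, A δ)))
        (Set.Finite.of_finite_image (f := fun β => (β, A δ)) ((hfin (G δ)).subset (by
          rintro _ ⟨β, hβ, rfl⟩; exact hβ)) (fun a _ b _ hab => (Prod.ext_iff.mp hab).1))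
    choose c hc using this
    refine ⟨c, fun ⟨β, α⟩ => ?_⟩
    ext γ
    refine (hT (β, α) _ γ).trans ?_
    change ρ β (c _) = _
    rw [hc]
    obtain ⟨e1, e2⟩ := huniq _ _ _ _ (hGA (p ^ e • γ + emb α))
    rw [← e1, ← e2]

/-- The Frobenius of a power series ring over a field is flat. -/
theorem eqFlatPow [Field k] (p : ℕ) [Fact p.Prime] [CharP k p] (e : ℕ) :
    EqFlatPow (MvPowerSeries (Fin n) k) (p ^ e) := by
  intro m a w hw
  obtain ⟨ι, ρ, h1, h2, h3, h4⟩ := exists_frobenius_coordinates (n := n) (k := k) p e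
  let R := MvPowerSeries (Fin n) k
  let 𝔪 : Ideal R := Ideal.span (Set.range X)
  let K : Submodule R (Fin m → R) := LinearMap.ker (Fintype.linearCombination R a)
  have hK : ∀ v : Fin m → R, v ∈ K ↔ ∑ i, v i * a i = 0 := fun v => by
    simp [K, Fintype.linearCombination_apply]
  obtain ⟨l, s, hs⟩ := Submodule.fg_iff_exists_fin_generating_family.mp (IsNoetherian.noetherian K)
  have hsK : ∀ j, s j ∈ K := fun j => hs ▸ Submodule.subset_span ⟨j, rfl⟩
  -- The Artin–Rees constant: a syzygy of order `N + c` is a combination of the generators `s` with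
  -- coefficients of order `N`.
  obtain ⟨c, hc⟩ := 𝔪.exists_pow_inf_eq_pow_smul K
  have hpi : ∀ N (v : Fin m → R), (∀ i, v i ∈ 𝔪 ^ N) → v ∈ (𝔪 ^ N • ⊤ : Submodule R (Fin m → R)) := by
    intro N v hv
    rw [pi_eq_sum_univ' v]
    exact Submodule.sum_mem _ fun i _ => Submodule.smul_mem_smul (hv i) trivial
  -- lifts of syzygies with control of the order
  have hlift : ∀ N (v : Fin m → R), v ∈ K → (∀ i, v i ∈ 𝔪 ^ (N + c)) →
      ∃ h : Fin l → R, (∀ j, h j ∈ 𝔪 ^ N) ∧ v = ∑ j, h j • s j := by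
    intro N v hvK hv
    have hv' : v ∈ 𝔪 ^ N • (Submodule.span R (Set.range s)) := by
      have h0 : v ∈ (𝔪 ^ (N + c) • ⊤ ⊓ K : Submodule R (Fin m → R)) := ⟨hpi _ v hv, hvK⟩
      rw [hc _ (by omega), Nat.add_sub_cancel] at h0
      rw [hs]
      exact Submodule.smul_mono le_rfl inf_le_right h0
    obtain ⟨h, hh, hh'⟩ := (Submodule.mem_ideal_smul_span_iff_exists_sum _ _ _).mp hv'
    refine ⟨h, hh, ?_⟩
    rw [← hh', Finsupp.sum_fintype]
    simp
  -- One lift serves all orders `N` at once: take it at the largest admissible order if there is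
  -- one, take `0` if `v = 0`, and any lift if no order is admissible.
  have hlift' : ∀ v ∈ K, ∃ h : Fin l → R, v = ∑ j, h j • s j ∧
      ∀ N, (∀ i, v i ∈ 𝔪 ^ (N + c)) → ∀ j, h j ∈ 𝔪 ^ N := by
    intro v hvK
    by_cases hall : ∀ N, ∀ i, v i ∈ 𝔪 ^ (N + c)
    · refine ⟨0, ?_, fun N _ j => by simp⟩
      have : v = 0 := by
        funext i
        ext d
        exact (mem_span_X_pow_iff (d.degree + 1 + c) _).mp (hall _ i) d (by omega)
      simp [this]
    · push Not at hall
      classical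
      have hmin := fun M => Nat.find_min (m := M) hall
      have hspec := Nat.find_spec hall
      set N₀ := Nat.find hall
      have hNle : ∀ N, (∀ i, v i ∈ 𝔪 ^ (N + c)) → N < N₀ := by
        intro N hN
        by_contra hlt
        obtain ⟨i, hi⟩ := hspec
        exact hi (Ideal.pow_le_pow_right (by omega) (hN i))
      by_cases h0 : N₀ = 0
      · have : v ∈ Submodule.span R (Set.range s) := hs ▸ hvK
        obtain ⟨h, hh⟩ := (Submodule.mem_span_range_iff_exists_fun R).mp this
        exact ⟨h, hh.symm, fun N hN => absurd (hNle N hN) (by omega)⟩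
      · have hv : ∀ i, v i ∈ 𝔪 ^ (N₀ - 1 + c) := by
          have := hmin (N₀ - 1) (by omega)
          push Not at this
          exact this
        obtain ⟨h, hh, hh'⟩ := hlift _ v hvK hv
        exact ⟨h, hh', fun N hN j => Ideal.pow_le_pow_right (by have := hNle N hN; omega) (hh j)⟩
  -- A coordinate function takes the `q`-th powers `a i ^ q` out as factors `a i`, so each
  -- coordinate of the given relation is a syzygy of `a`.
  have hrel : ∀ x, (fun i => ρ x (w i)) ∈ K := by
    intro x
    rw [hK]
    have := congrArg (ρ x) hw
    simpa [mul_comm _ (a _ ^ p ^ e), h1, mul_comm (a _)] using this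
  choose h hh hh' using fun x => hlift' _ (hrel x)
  -- This is what the order control is for: the coefficient at `γ` can be nonzero only if some `ρ x
  -- (w i)` has a nonzero coefficient of degree below `γ.degree + 1 + c`. The lifts then reassemble
  -- into power series `C j`.
  have hfin : ∀ j γ, {x | coeff γ (h x j) ≠ 0}.Finite := by
    intro j γ
    have hF : (⋃ i : Fin m, ⋃ δ ∈ {δ : Fin n →₀ ℕ | δ.degree < γ.degree + 1 + c},
        {x | coeff δ (ρ x (w i)) ≠ 0}).Finite :=
      Set.finite_iUnion fun i => (Finsupp.finite_of_degree_lt _).biUnion fun δ _ => h2 _ _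
    refine hF.subset fun x hx => ?_
    by_contra hnot
    simp only [Set.mem_iUnion, not_exists] at hnot
    refine hx ((mem_span_X_pow_iff _ _).mp (hh' x (γ.degree + 1) (fun i => ?_) j) γ (by omega))
    refine (mem_span_X_pow_iff _ _).mpr fun δ hδ => ?_
    by_contra h0
    exact hnot i δ hδ h0
  choose C hC using fun j => h4 (fun x => h x j) (hfin j)
  refine ⟨l, C, s, fun i => ?_, fun j => (hK _).mp (hsK j)⟩
  rw [← sub_eq_zero]
  refine h3 _ fun x => ?_
  rw [map_sub, sub_eq_zero, map_sum]
  have := congrFun (hh x) i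
  simp only [Finset.sum_apply, Pi.smul_apply, smul_eq_mul] at this
  rw [this]
  refine Finset.sum_congr rfl fun j _ => ?_
  rw [mul_comm (C j), h1, hC, mul_comm]

end MvPowerSeries

/-! ### Flatness of the Frobenius under localization -/

theorem EqFlatPow.of_isLocalization {R : Type*} [CommRing R] {q : ℕ} (h : EqFlatPow R q)
    (M : Submonoid R) (W : Type*) [CommRing W] [Algebra R W] [IsLocalization M W] :
    EqFlatPow W q := by
  intro m a w hw
  obtain ⟨σ, hσ⟩ := IsLocalization.exist_integer_multiples_of_finite M a
  obtain ⟨σ', hσ'⟩ := IsLocalization.exist_integer_multiples_of_finite M w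
  choose α hα using hσ
  choose ω hω using hσ'
  simp only [Algebra.smul_def] at hα hω
  have h0 : algebraMap R W (∑ i, ω i * α i ^ q) = algebraMap R W 0 := by
    rw [map_zero, map_sum, ← mul_zero (algebraMap R W σ' * algebraMap R W σ ^ q), ← hw,
      Finset.mul_sum]
    refine Finset.sum_congr rfl fun i _ => ?_
    rw [map_mul, map_pow, hα, hω]
    ring
  obtain ⟨τ, hτ⟩ := (IsLocalization.eq_iff_exists M W).mp h0
  obtain ⟨l, c, b, h1, h2⟩ := h α (fun i => τ * ω i) (by
    rw [mul_zero, Finset.mul_sum] at hτ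
    simpa only [mul_assoc] using hτ)
  have hu : IsUnit (algebraMap R W τ * algebraMap R W σ') :=
    (IsLocalization.map_units W τ).mul (IsLocalization.map_units W σ')
  obtain ⟨v, hv⟩ := hu.exists_left_inv
  refine ⟨l, fun j => v * algebraMap R W (c j), fun j i => algebraMap R W (b j i),
    fun i => ?_, fun j => ?_⟩
  · have := congrArg (algebraMap R W) (h1 i)
    rw [map_mul, hω, map_sum] at this
    calc w i = v * (algebraMap R W τ * (algebraMap R W σ' * w i)) := by
          rw [← mul_assoc (algebraMap R W τ), ← mul_assoc, hv, one_mul]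
      _ = _ := by
          rw [this, Finset.mul_sum]
          refine Finset.sum_congr rfl fun j _ => ?_
          rw [map_mul, map_pow, mul_assoc]
  · refine (IsLocalization.map_units W σ).mul_left_cancel ?_
    have := congrArg (algebraMap R W) (h2 j)
    rw [map_sum, map_zero] at this
    rw [mul_zero, ← this, Finset.mul_sum]
    refine Finset.sum_congr rfl fun i _ => ?_
    rw [map_mul, hα]
    ring

/-! ### Local rings with flat Frobenius: the generators of the maximal ideal -/

section Lech

open IsLocalRing

variable {W : Type*} [CommRing W]

/-- Independence in the sense of Lech. -/
def LechIndependent {h : ℕ} (f : Fin h → W) : Prop :=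
  ∀ a : Fin h → W, ∑ i, a i * f i = 0 → ∀ i, a i ∈ Ideal.span (Set.range f)

/-- Multiplying a relation of `f` by `g` gives a relation of the modified family, so `a i` is a
combination `∑ b j * f' j`. Substituting this back gives a second relation of that family, with
coefficients `a j + b j * f i` at `j ≠ i`, which places the other `a j` in the ideal. -/
theorem LechIndependent.of_update {h : ℕ} {f : Fin h → W} {i : Fin h} {g : W}
    (H : LechIndependent (Function.update f i (f i * g))) : LechIndependent f := by
  classical
  set f' := Function.update f i (f i * g) with hf'
  have hi : f' i = f i * g := by simp [hf']
  have hne : ∀ j, j ≠ i → f' j = f j := fun j hj => by simp [hf', hj]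
  have hle : Ideal.span (Set.range f') ≤ Ideal.span (Set.range f) := by
    refine Ideal.span_le.mpr ?_
    rintro _ ⟨j, rfl⟩
    by_cases hj : j = i
    · subst hj
      rw [hi]
      exact Ideal.mul_mem_right _ _ (Ideal.subset_span ⟨j, rfl⟩)
    · rw [hne j hj]
      exact Ideal.subset_span ⟨j, rfl⟩
  intro a ha
  have h1 : ∑ j, Function.update (fun j => g * a j) i (a i) j * f' j = 0 := by
    rw [← mul_zero g, ← ha, Finset.mul_sum]
    refine Finset.sum_congr rfl fun j _ => ?_
    by_cases hj : j = i
    · subst hj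
      rw [hi, Function.update_self]
      ring
    · rw [hne j hj, Function.update_of_ne hj]
      ring
  have hai' := H _ h1 i
  rw [Function.update_self] at hai'
  have hai := hle hai'
  obtain ⟨b, hb⟩ := (Submodule.mem_span_range_iff_exists_fun W).mp hai'
  simp only [smul_eq_mul] at hb
  -- substitute the expression for `a i`
  have h2 : ∑ j, Function.update (fun j => a j + b j * f i) i (b i * f i) j * f' j = 0 := by
    rw [← ha]
    have e1 : ∑ j, a j * f j = a i * f i + ∑ j ∈ Finset.univ.erase i, a j * f j :=
      (Finset.add_sum_erase _ _ (Finset.mem_univ i)).symm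
    have e2 : a i = b i * f' i + ∑ j ∈ Finset.univ.erase i, b j * f' j := by
      rw [← hb]
      exact (Finset.add_sum_erase _ _ (Finset.mem_univ i)).symm
    rw [e1, e2, ← Finset.add_sum_erase _ _ (Finset.mem_univ i), Function.update_self, add_mul,
      Finset.sum_mul, add_assoc, ← Finset.sum_add_distrib]
    congr 1
    · ring
    · refine Finset.sum_congr rfl fun j hj => ?_
      have hj := Finset.ne_of_mem_erase hj
      rw [hne j hj, Function.update_of_ne hj]
      ring
  intro j
  by_cases hj : j = i
  · rw [hj]; exact hai
  · have := hle (H _ h2 j)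
    rw [Function.update_of_ne hj] at this
    exact (Ideal.add_mem_iff_left _
      (Ideal.mul_mem_left _ _ (Ideal.subset_span (Set.mem_range_self i)))).mp this

theorem LechIndependent.of_mul {h : ℕ} {f g : Fin h → W}
    (H : LechIndependent (fun j => f j * g j)) : LechIndependent f := by
  classical
  suffices ∀ T : Finset (Fin h), LechIndependent (fun j => if j ∈ T then f j * g j else f j) →
      LechIndependent f from this Finset.univ (by simpa using H)
  intro T
  induction T using Finset.induction_on with
  | empty => simp
  | insert i T hi ih =>
    intro hT
    refine ih (LechIndependent.of_update (i := i) (g := g i) ?_)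
    convert hT using 1
    funext j
    by_cases hj : j = i
    · subst hj
      simp [hi]
    · simp [hj]

/-- The ideal generated by the powers `y_i ^ {s_i}`. -/
def powIdeal {h : ℕ} (y : Fin h → W) (s : Fin h → ℕ) : Ideal W :=
  Ideal.span (Set.range fun i => y i ^ s i)

theorem pow_mem_powIdeal {h : ℕ} (y : Fin h → W) (s : Fin h → ℕ) (i : Fin h) {t : ℕ}
    (ht : s i ≤ t) : y i ^ t ∈ powIdeal y s := by
  rw [← Nat.sub_add_cancel ht, pow_add]
  exact Ideal.mul_mem_left _ _ (Ideal.subset_span ⟨i, rfl⟩)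

theorem mem_powIdeal_iff {h : ℕ} (y : Fin h → W) (s : Fin h → ℕ) (i : Fin h) (a : W) :
    a ∈ powIdeal y s ↔ ∃ b, a - b * y i ^ s i ∈ Ideal.span ((fun j => y j ^ s j) '' {j | j ≠ i}) := by
  have hr : (Set.range fun j => y j ^ s j) = insert (y i ^ s i) ((fun j => y j ^ s j) '' {j | j ≠ i}) := by
    ext x
    constructor
    · rintro ⟨j, rfl⟩
      by_cases hj : j = i
      · subst hj; exact Or.inl rfl
      · exact Or.inr ⟨j, hj, rfl⟩
    · rintro (rfl | ⟨j, _, rfl⟩)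
      exacts [⟨i, rfl⟩, ⟨j, rfl⟩]
  rw [powIdeal, hr, Ideal.mem_span_insert]
  constructor
  · rintro ⟨b, z, hz, rfl⟩
    exact ⟨b, by simpa using hz⟩
  · rintro ⟨b, hb⟩
    exact ⟨b, _, hb, by ring⟩

/-- Krull's intersection theorem for the `W`-module `W ⧸ I`. -/
theorem mem_of_forall_mem_sup_pow [IsLocalRing W] [IsNoetherianRing W] (I : Ideal W) (a : W)
    (ha : ∀ t, a ∈ I ⊔ maximalIdeal W ^ t) : a ∈ I := by
  rw [← Ideal.Quotient.eq_zero_iff_mem, ← Submodule.mem_bot W,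
    ← Ideal.iInf_pow_smul_eq_bot_of_isLocalRing (maximalIdeal W) (Ideal.IsPrime.ne_top'),
    Submodule.mem_iInf]
  intro t
  obtain ⟨x, hx, z, hz, rfl⟩ := Submodule.mem_sup.mp (ha t)
  rw [map_add, Ideal.Quotient.eq_zero_iff_mem.mpr hx, zero_add]
  have : (Ideal.Quotient.mk I z) = z • (1 : W ⧸ I) := by
    rw [Algebra.smul_def, mul_one]; rfl
  rw [this]
  exact Submodule.smul_mem_smul hz trivial

variable (W) in
/-- Minimal generators of the maximal ideal. -/
theorem exists_minimal_generators [IsLocalRing W] [IsNoetherianRing W] :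
    ∃ (h : ℕ) (y : Fin h → W), Ideal.span (Set.range y) = maximalIdeal W ∧
      ∀ a : Fin h → W, ∑ i, a i * y i = 0 → ∀ i, a i ∈ maximalIdeal W := by
  classical
  have hex : ∃ h : ℕ, ∃ y : Fin h → W, Ideal.span (Set.range y) = maximalIdeal W :=
    Submodule.fg_iff_exists_fin_generating_family.mp (maximalIdeal W).fg_of_isNoetherianRing
  obtain ⟨y, hy⟩ := Nat.find_spec hex
  refine ⟨Nat.find hex, y, hy, fun a ha i => ?_⟩
  -- A unit coefficient would make `y i` redundant, whereas the number of generators is the least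
  -- possible.
  by_contra hi
  have hu : IsUnit (a i) := by simpa using hi
  obtain ⟨v, hv⟩ := hu.exists_left_inv
  generalize hH : Nat.find hex = H at y i a
  obtain _ | h := H
  · exact i.elim0
  · refine Nat.find_min hex (m := h) (by omega) ⟨fun j => y (i.succAbove j), ?_⟩
    rw [← hy]
    refine le_antisymm (Ideal.span_mono (Set.range_comp_subset_range _ _)) (Ideal.span_le.mpr ?_)
    rintro _ ⟨j, rfl⟩
    by_cases hj : j = i
    · subst hj
      rw [Fin.sum_univ_succAbove _ j] at ha
      have : y j = - ∑ l, v * a (j.succAbove l) * y (j.succAbove l) := by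
        calc y j = v * (a j * y j) := by rw [← mul_assoc, hv, one_mul]
          _ = _ := by
            rw [eq_neg_of_add_eq_zero_left ha, mul_neg, Finset.mul_sum]
            simp only [mul_assoc]
      rw [this]
      exact neg_mem (Ideal.sum_mem _ fun l _ => Ideal.mul_mem_left _ _ (Ideal.subset_span ⟨l, rfl⟩))
    · obtain ⟨l, rfl⟩ := Fin.exists_succAbove_eq hj
      exact Ideal.subset_span ⟨l, rfl⟩

variable [IsLocalRing W] [IsNoetherianRing W] (p : ℕ) [Fact p.Prime] [CharP W p]
  (hflat : ∀ e, EqFlatPow W (p ^ e)) {h : ℕ} {y : Fin h → W}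
  (hy : Ideal.span (Set.range y) = maximalIdeal W)
  (hmin : ∀ a : Fin h → W, ∑ i, a i * y i = 0 → ∀ i, a i ∈ maximalIdeal W)

-- For exponents all equal to `q = p ^ e`, flatness writes the coefficients of a relation as
-- combinations of `q`-th powers of entries of relations of `y`. By minimality these entries lie in
-- `(y)`, so their `q`-th powers lie in `(y_i ^ q)`. Smaller exponents follow by passing to factors.
omit [IsNoetherianRing W] in
include hflat hy hmin in
theorem lechIndependent_pow (s : Fin h → ℕ) : LechIndependent fun i => y i ^ s i := by
  obtain ⟨e, he⟩ : ∃ e, ∀ i, s i ≤ p ^ e := by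
    obtain ⟨e, he⟩ := pow_unbounded_of_one_lt (∑ i, s i) (Fact.out : p.Prime).one_lt
    exact ⟨e, fun i => (Finset.single_le_sum (fun _ _ => Nat.zero_le _)
      (Finset.mem_univ i)).trans he.le⟩
  suffices H : LechIndependent fun i => y i ^ p ^ e by
    refine LechIndependent.of_mul (g := fun i => y i ^ (p ^ e - s i)) ?_
    convert H using 2 with i
    rw [← pow_add, Nat.add_sub_cancel' (he i)]
  intro a ha i
  obtain ⟨l, c, b, h1, h2⟩ := hflat e y a ha
  rw [h1]
  refine Ideal.sum_mem _ fun j _ => Ideal.mul_mem_left _ _ ?_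
  have hb := hmin _ (h2 j) i
  rw [← hy] at hb
  obtain ⟨r, hr⟩ := (Submodule.mem_span_range_iff_exists_fun W).mp hb
  rw [← hr, sum_pow_char_pow]
  refine Ideal.sum_mem _ fun t _ => ?_
  rw [smul_eq_mul, mul_pow]
  exact Ideal.mul_mem_left _ _ (Ideal.subset_span ⟨t, rfl⟩)

include hflat hy hmin in
/-- Each `y i` is a nonzerodivisor modulo powers of the other ones. -/
theorem mem_span_of_mul_pow_mem (s : Fin h → ℕ) (i : Fin h) (a : W) (t : ℕ)
    (ha : a * y i ^ t ∈ Ideal.span ((fun j => y j ^ s j) '' {j | j ≠ i})) :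
    a ∈ Ideal.span ((fun j => y j ^ s j) '' {j | j ≠ i}) := by
  classical
  set I := Ideal.span ((fun j => y j ^ s j) '' {j | j ≠ i}) with hI
  -- Multiplying by a further `y i ^ N` and using independence with exponent `t + N` at `i` gives `a
  -- ∈ I + (y i ^ (t + N))`, which is in `I + 𝔪 ^ N`.
  refine mem_of_forall_mem_sup_pow I a fun N => ?_
  have h1 : a * y i ^ (t + N) ∈ I := by
    rw [pow_add, ← mul_assoc]
    exact Ideal.mul_mem_right _ _ ha
  obtain ⟨c, hc⟩ : ∃ c : Fin h → W, a * y i ^ (t + N) = ∑ j ∈ Finset.univ.erase i, c j * y j ^ s j := by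
    have : I = Ideal.span (((Finset.univ.erase i).image fun j => y j ^ s j : Finset W) : Set W) := by
      rw [hI]; congr 1; ext; simp
    rw [this] at h1
    rw [Finset.coe_image] at h1
    obtain ⟨c, hc⟩ := (Submodule.mem_span_image_finset_iff_exists_fun W).mp h1
    refine ⟨fun j => if hj : j ∈ Finset.univ.erase i then c ⟨j, hj⟩ else 0, ?_⟩
    rw [← hc, Finset.univ_eq_attach, ← Finset.sum_attach (Finset.univ.erase i)]
    exact Finset.sum_congr rfl fun j _ => by beta_reduce; rw [dif_pos j.2, smul_eq_mul]
  have h2 := lechIndependent_pow p hflat hy hmin (Function.update s i (t + N))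
    (Function.update (fun j => - c j) i a) (by
      rw [← Finset.add_sum_erase _ _ (Finset.mem_univ i)]
      beta_reduce
      rw [Function.update_self, Function.update_self, hc, ← Finset.sum_add_distrib]
      refine Finset.sum_eq_zero fun j hj => ?_
      have hj := Finset.ne_of_mem_erase hj
      rw [Function.update_of_ne hj, Function.update_of_ne hj]
      ring) i
  rw [Function.update_self] at h2
  refine Ideal.span_le.mpr ?_ h2
  rintro _ ⟨j, rfl⟩
  by_cases hj : j = i
  · subst hj
    simp only [Function.update_self]
    refine Ideal.mem_sup_right (Ideal.pow_le_pow_right (Nat.le_add_left N t) (Ideal.pow_mem_pow ?_ _))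
    rw [← hy]
    exact Ideal.subset_span ⟨j, rfl⟩
  · simp only [Function.update_of_ne hj]
    exact Ideal.mem_sup_left (Ideal.subset_span ⟨j, hj, rfl⟩)

include hflat hy hmin in
theorem mem_powIdeal_update (s : Fin h → ℕ) (i : Fin h) (a : W) (r t : ℕ)
    (ha : a * y i ^ t ∈ powIdeal y (Function.update s i (r + t))) :
    a ∈ powIdeal y (Function.update s i r) := by
  have him : ∀ r, (fun j => y j ^ Function.update s i r j) '' {j | j ≠ i} =
      (fun j => y j ^ s j) '' {j | j ≠ i} := fun r => by
    refine Set.image_congr fun j hj => ?_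
    rw [Function.update_of_ne hj]
  rw [mem_powIdeal_iff y _ i, Function.update_self, him] at ha ⊢
  obtain ⟨b, hb⟩ := ha
  refine ⟨b, mem_span_of_mul_pow_mem p hflat hy hmin s i _ t ?_⟩
  convert hb using 1
  ring

include hflat hy hmin in
theorem mem_powIdeal_of_mul_prod (T : Finset (Fin h)) (s : Fin h → ℕ) (a : W) (t : ℕ)
    (ha : a * ∏ i ∈ T, y i ^ t ∈ powIdeal y (fun i => if i ∈ T then s i + t else s i)) :
    a ∈ powIdeal y s := by
  classical
  induction T using Finset.induction_on with
  | empty => simpa using ha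
  | insert i T hi ih =>
    refine ih ?_
    rw [Finset.prod_insert hi, mul_comm (y i ^ t), ← mul_assoc] at ha
    have e1 : (fun j => if j ∈ insert i T then s j + t else s j) =
        Function.update (fun j => if j ∈ T then s j + t else s j) i (s i + t) := by
      funext j
      by_cases hj : j = i
      · subst hj; simp
      · simp [hj]
    have e2 : (fun j => if j ∈ T then s j + t else s j) =
        Function.update (fun j => if j ∈ T then s j + t else s j) i (s i) := by
      funext j
      by_cases hj : j = i
      · subst hj; simp [hi]
      · simp [hj]
    rw [e1] at ha
    rw [e2]
    exact mem_powIdeal_update p hflat hy hmin _ _ _ _ _ ha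

-- Injectivity of the transition maps `W / (y_i ^ s) → W / (y_i ^ (s + t))`, multiplication by `(∏
-- y_i) ^ t`, in the direct system defining local cohomology.
include hflat hy hmin in
theorem mem_powIdeal_of_mul_prod_pow (s t : ℕ) (a : W)
    (ha : a * (∏ i, y i) ^ t ∈ powIdeal y (fun _ => s + t)) : a ∈ powIdeal y fun _ => s := by
  refine mem_powIdeal_of_mul_prod p hflat hy hmin Finset.univ _ a t ?_
  simpa [Finset.prod_pow] using ha

include hflat hy hmin in
/-- The socle modulo `y_1 ^ s, …, y_h ^ s` is generated by the product of the `y_i ^ (s - 1)`. -/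
theorem exists_sub_mem_powIdeal (s : ℕ) (a : W)
    (ha : ∀ i, a * y i ∈ powIdeal y (fun _ => s + 1)) :
    ∃ b, a - b * (∏ i, y i) ^ s ∈ powIdeal y (fun _ => s + 1) := by
  classical
  suffices ∀ T : Finset (Fin h), ∃ b, a - b * ∏ i ∈ T, y i ^ s ∈ powIdeal y (fun _ => s + 1) by
    simpa [Finset.prod_pow] using this Finset.univ
  intro T
  induction T using Finset.induction_on with
  | empty => exact ⟨a, by simp⟩
  | insert i T hi ih =>
    obtain ⟨b, hb⟩ := ih
    have h1 : b * y i * ∏ j ∈ T, y j ^ s ∈ powIdeal y (fun _ => s + 1) := by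
      have := Ideal.sub_mem _ (ha i) (Ideal.mul_mem_right (y i) _ hb)
      convert this using 1
      ring
    -- The exponents left after cancelling `∏ j ∈ T, y j ^ s`. As `i ∉ T`, the exponent at `i` is `s
    -- + 1`, and cancelling `y i` lowers it to `s`.
    set r : Fin h → ℕ := fun j => if j ∈ T then 1 else s + 1 with hr
    have h2 : b * y i ∈ powIdeal y r := by
      refine mem_powIdeal_of_mul_prod p hflat hy hmin T r _ s ?_
      convert h1 using 2
      funext j
      simp only [hr]
      split_ifs <;> ring
    have h3 : b ∈ powIdeal y (Function.update r i s) := by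
      refine mem_powIdeal_update p hflat hy hmin r i b s 1 ?_
      rw [pow_one]
      convert h2 using 2
      funext j
      by_cases hj : j = i
      · subst hj; simp [hr, hi]
      · simp [hj]
    obtain ⟨b', hb'⟩ := (mem_powIdeal_iff y _ i b).mp h3
    rw [Function.update_self] at hb'
    refine ⟨b', ?_⟩
    rw [Finset.prod_insert hi]
    have h4 : (b - b' * y i ^ s) * ∏ j ∈ T, y j ^ s ∈ powIdeal y (fun _ => s + 1) := by
      refine Submodule.span_induction (p := fun x _ => x * ∏ j ∈ T, y j ^ s ∈ powIdeal y (fun _ => s + 1))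
        ?_ ?_ ?_ ?_ hb'
      · rintro _ ⟨j, hj, rfl⟩
        have hj : j ≠ i := hj
        simp only [Function.update_of_ne hj, hr]
        split_ifs with hjT
        · rw [← Finset.mul_prod_erase _ _ hjT, ← mul_assoc, ← pow_add, add_comm 1 s]
          exact Ideal.mul_mem_right _ _ (pow_mem_powIdeal y _ j le_rfl)
        · exact Ideal.mul_mem_right _ _ (pow_mem_powIdeal y _ j le_rfl)
      · simp
      · intro u v _ _ hu hv
        rw [add_mul]; exact add_mem hu hv
      · intro c u _ hu
        rw [smul_eq_mul, mul_assoc]; exact Ideal.mul_mem_left _ _ hu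
    convert add_mem hb h4 using 1
    ring

end Lech

/-! ### The injective hull of the residue field -/

/-- A linear map extends along a map with smaller kernel. -/
theorem Module.Injective.exists_comp_eq {R : Type u} [CommRing R] {D : Type u} [AddCommGroup D]
    [Module R D] (hD : Module.Injective R D) {P D' : Type u} [AddCommGroup P] [Module R P]
    [AddCommGroup D'] [Module R D'] (π : P →ₗ[R] D') (ψ : P →ₗ[R] D)
    (h : LinearMap.ker π ≤ LinearMap.ker ψ) : ∃ g : D' →ₗ[R] D, ∀ x, g (π x) = ψ x := by
  obtain ⟨g, hg⟩ := Module.Injective.extension_property R D _ _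
    ((LinearMap.ker π).liftQ π le_rfl) (LinearMap.ker_eq_bot.mp (Submodule.ker_liftQ_eq_bot _ _ _ le_rfl))
    ((LinearMap.ker π).liftQ ψ h)
  exact ⟨g, fun x => LinearMap.congr_fun hg ((LinearMap.ker π).mkQ x)⟩

section Hull

open IsLocalRing

variable {A : Type u} [CommRing A] [IsLocalRing A] {E : Type u} [AddCommGroup E] [Module A E]
  {ι : ResidueField A →ₗ[A] E}

theorem residueField_smul_one (a : A) : a • (1 : ResidueField A) = residue A a := by
  rw [Algebra.smul_def, mul_one]; rfl

theorem IsInjectiveHull.smul_one_eq_zero (ι : ResidueField A →ₗ[A] E) {a : A}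
    (ha : a ∈ maximalIdeal A) : a • ι 1 = 0 := by
  rw [← map_smul, residueField_smul_one, (residue_eq_zero_iff a).mpr ha, map_zero]

theorem IsInjectiveHull.map_one_ne_zero (hι : IsInjectiveHull ι) : ι 1 ≠ 0 :=
  (map_ne_zero_iff ι hι.injective).mpr one_ne_zero

/-- By essentiality a nonzero multiple of `x` lies in the image of the residue field; dividing by a
unit makes it `ι 1`. -/
theorem IsInjectiveHull.exists_smul_eq (hι : IsInjectiveHull ι) {x : E} (hx : x ≠ 0) :
    ∃ a : A, a • x = ι 1 := by
  obtain ⟨y, ⟨hy, r, hr⟩, hy0⟩ := Submodule.exists_mem_ne_zero_of_ne_bot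
    (hι.essential (A ∙ x) (by simpa using hx))
  obtain ⟨a, rfl⟩ := Submodule.mem_span_singleton.mp hy
  obtain ⟨r, rfl⟩ := residue_surjective r
  have hu : IsUnit r := by
    by_contra h
    exact hy0 (by rw [← hr, (residue_eq_zero_iff r).mpr ((mem_maximalIdeal r).mpr h), map_zero])
  obtain ⟨v, hv⟩ := hu.exists_left_inv
  refine ⟨v * a, ?_⟩
  rw [mul_smul, ← hr, ← residueField_smul_one, map_smul, ← mul_smul, hv, one_smul]

/-- The elements of the injective hull of the residue field are torsion. -/
theorem IsInjectiveHull.exists_pow_smul_eq_zero [IsNoetherianRing A] (hι : IsInjectiveHull ι)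
    (x : E) : ∃ s, ∀ a ∈ maximalIdeal A ^ s, a • x = 0 := by
  have hrad : maximalIdeal A ≤ (Ideal.torsionOf A E x).radical := by
    intro a ha
    -- The annihilators of the `a ^ i • x` become stationary. If `b` carries a stable nonzero `a ^ n
    -- • x` to `ι 1`, it kills `a ^ (n + 1) • x`, hence also `a ^ n • x`, a contradiction.
    let f : ℕ →o Ideal A := ⟨fun i => Ideal.torsionOf A E (a ^ i • x), by
      refine monotone_nat_of_le_succ fun i b hb => ?_
      rw [Ideal.mem_torsionOf_iff] at hb ⊢
      rw [pow_succ', mul_smul, smul_comm, hb, smul_zero]⟩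
    obtain ⟨n, hn⟩ := monotone_stabilizes_iff_noetherian.mpr inferInstance f
    refine ⟨n, ?_⟩
    rw [Ideal.mem_torsionOf_iff]
    by_contra h0
    obtain ⟨b, hb⟩ := hι.exists_smul_eq h0
    have h1 : b ∈ f (n + 1) := by
      change b ∈ Ideal.torsionOf A E (a ^ (n + 1) • x)
      rw [Ideal.mem_torsionOf_iff, pow_succ', mul_smul, smul_comm, hb, smul_one_eq_zero ι ha]
    rw [← hn (n + 1) (Nat.le_succ n)] at h1
    exact hι.map_one_ne_zero (hb.symm.trans ((Ideal.mem_torsionOf_iff _ _).mp h1))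
  obtain ⟨s, hs⟩ := Ideal.exists_pow_le_of_le_radical_of_fg hrad (maximalIdeal A).fg_of_isNoetherianRing
  exact ⟨s, fun a ha => (Ideal.mem_torsionOf_iff _ _).mp (hs ha)⟩

/-- Matlis duality does not increase the length. -/
theorem IsInjectiveHull.length_hom_le (hι : IsInjectiveHull ι) {M : Type u} [AddCommGroup M]
    [Module A M] (hM : IsFiniteLength A M) :
    Module.length A (M →ₗ[A] E) ≤ Module.length A M := by
  have := hι.injective_module
  induction hM with
  | @of_subsingleton M =>
    have : Subsingleton (M →ₗ[A] E) := ⟨fun f g => by ext x; rw [Subsingleton.elim x 0]; simp⟩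
    simp
  | @of_simple_quotient M _ _ N hsimp hN ih =>
    have h1 : Module.length A ((M ⧸ N) →ₗ[A] E) ≤ 1 := by
      obtain ⟨I, hI, ⟨φ⟩⟩ := isSimpleModule_iff_quot_maximal.mp hsimp
      have hI : I = maximalIdeal A := eq_maximalIdeal hI
      subst hI
      let g := φ.symm 1
      -- A map from the simple quotient is determined by its value at the generator `g`, which the
      -- maximal ideal kills; such elements of `E` lie in the copy of the residue field.
      have hker : ∀ f : (M ⧸ N) →ₗ[A] E, f g ∈ LinearMap.range ι := by
        intro f
        by_cases h0 : f g = 0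
        · rw [h0]; exact zero_mem _
        · obtain ⟨a, ha⟩ := hι.exists_smul_eq h0
          have hu : IsUnit a := by
            by_contra h
            have ham : a ∈ maximalIdeal A := (mem_maximalIdeal a).mpr h
            refine hι.map_one_ne_zero ?_
            rw [← ha, ← map_smul, ← map_smul φ.symm]
            have : a • (1 : A ⧸ maximalIdeal A) = 0 := by
              rw [Algebra.smul_def, mul_one]
              exact Ideal.Quotient.eq_zero_iff_mem.mpr ham
            rw [this, map_zero, map_zero]
          obtain ⟨v, hv⟩ := hu.exists_left_inv
          exact ⟨v • 1, by rw [map_smul, ← ha, ← mul_smul, hv, one_smul]⟩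
      let ev : ((M ⧸ N) →ₗ[A] E) →ₗ[A] LinearMap.range ι :=
        (LinearMap.applyₗ g).codRestrict _ hker
      have hinj : Function.Injective ev := by
        rw [injective_iff_map_eq_zero]
        intro f hf
        have hfg : f g = 0 := congrArg Subtype.val hf
        ext x
        obtain ⟨a, ha⟩ := Ideal.Quotient.mk_surjective (φ (N.mkQ x))
        have hx : N.mkQ x = a • g := by
          rw [← map_smul, ← φ.symm_apply_apply (N.mkQ x), ← ha, Algebra.smul_def, mul_one]
          rfl
        change f (N.mkQ x) = 0
        rw [hx, map_smul, hfg, smul_zero]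
      refine (Module.length_le_of_injective ev hinj).trans ?_
      rw [← (LinearEquiv.ofInjective ι hι.injective).length_eq]
      have : IsSimpleModule A (ResidueField A) :=
        isSimpleModule_iff_quot_maximal.mpr ⟨maximalIdeal A, inferInstance, ⟨LinearEquiv.refl _ _⟩⟩
      exact (Module.length_eq_one A _).le
    rw [Module.length_eq_add_of_exact (LinearMap.lcomp A E N.mkQ) (LinearMap.lcomp A E N.subtype)
      ?_ ?_ ?_, Module.length_eq_add_of_exact N.subtype N.mkQ N.subtype_injective N.mkQ_surjective
      (LinearMap.exact_subtype_mkQ N), add_comm (Module.length A N)]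
    · refine add_le_add (h1.trans (Module.length_eq_one A _).ge) ih
    · intro f g hfg
      ext x
      exact LinearMap.congr_fun hfg x
    · intro f
      obtain ⟨g, hg⟩ := Module.Injective.extension_property A E N M N.subtype N.subtype_injective f
      exact ⟨g, hg⟩
    · intro f
      constructor
      · intro hf
        have hle : N ≤ LinearMap.ker f := fun x hx => LinearMap.congr_fun hf ⟨x, hx⟩
        refine ⟨N.liftQ f hle, ?_⟩
        ext x
        exact N.liftQ_apply f (h := hle) x
      · rintro ⟨g, rfl⟩
        ext x
        change g (N.mkQ x) = 0
        rw [show N.mkQ (x : M) = 0 by simp, map_zero]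

theorem isFiniteLength_quotient [IsNoetherianRing A] {I : Ideal A} {N : ℕ}
    (hN : maximalIdeal A ^ N ≤ I) : IsFiniteLength A (A ⧸ I) := by
  rcases subsingleton_or_nontrivial (A ⧸ I) with h | h
  · exact .of_subsingleton
  · have : IsLocalRing (A ⧸ I) :=
      IsLocalRing.of_surjective' (Ideal.Quotient.mk I) Ideal.Quotient.mk_surjective
    have : IsArtinianRing (A ⧸ I) := by
      rw [isArtinianRing_iff_isNilpotent_maximalIdeal]
      refine ⟨N, ?_⟩
      rw [← IsLocalRing.map_maximalIdeal_of_surjective (Ideal.Quotient.mk I) Ideal.Quotient.mk_surjective,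
        ← Ideal.map_pow]
      exact Ideal.map_mk_eq_bot_of_le hN
    have : IsArtinian A (A ⧸ I) :=
      isArtinian_of_surjective_algebraMap (R := A ⧸ I) Ideal.Quotient.mk_surjective
    exact isFiniteLength_iff_isNoetherian_isArtinian.mpr ⟨inferInstance, this⟩

/-- If `f : A → E` has a kernel `I` that contains a power of the maximal ideal, its image is the
`I`-torsion of the injective hull `E` of the residue field. -/
theorem IsInjectiveHull.mem_range_of_ker [IsNoetherianRing A] (hι : IsInjectiveHull ι)
    (f : A →ₗ[A] E) {N : ℕ} (hN : maximalIdeal A ^ N ≤ LinearMap.ker f) {x : E}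
    (hx : ∀ a ∈ LinearMap.ker f, a • x = 0) : x ∈ LinearMap.range f := by
  set I : Ideal A := LinearMap.ker f with hI
  have hfl : IsFiniteLength A (A ⧸ I) := isFiniteLength_quotient hN
  let T : Submodule A E := Submodule.torsionBySet A E I
  -- The `I`-torsion embeds in `Hom (A ⧸ I, E)`, so it is no longer than `A ⧸ I`. The range of `f`
  -- is a copy of `A ⧸ I` inside it, so the two coincide.
  have hT : Module.length A T ≤ Module.length A (A ⧸ I) := by
    refine le_trans ?_ (hι.length_hom_le hfl)
    let g : T →ₗ[A] ((A ⧸ I) →ₗ[A] E) :=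
      { toFun := fun t => I.liftQ (LinearMap.toSpanSingleton A E t) fun w hw => by
          simpa using (Submodule.mem_torsionBySet_iff _ _).mp t.2 ⟨w, hw⟩
        map_add' := fun t t' => by
          refine LinearMap.ext fun q => ?_
          obtain ⟨w, rfl⟩ := Ideal.Quotient.mk_surjective q
          exact smul_add w (t : E) t'
        map_smul' := fun c t => by
          refine LinearMap.ext fun q => ?_
          obtain ⟨w, rfl⟩ := Ideal.Quotient.mk_surjective q
          exact smul_comm w c (t : E) }
    refine Module.length_le_of_injective g ?_
    rw [injective_iff_map_eq_zero]
    intro t ht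
    have : (1 : A) • (t : E) = 0 := LinearMap.congr_fun ht (Ideal.Quotient.mk I 1)
    exact Subtype.ext (by simpa using this)
  have hrT : LinearMap.range f ≤ T := by
    rintro _ ⟨w, rfl⟩
    refine (Submodule.mem_torsionBySet_iff _ _).mpr fun c => ?_
    rw [← map_smul, smul_eq_mul, mul_comm, ← smul_eq_mul, map_smul,
      show f (c : A) = 0 from c.2, smul_zero]
  have hTfl : IsFiniteLength A T := by
    rw [← Module.length_ne_top_iff] at hfl ⊢
    exact ne_top_of_le_ne_top hfl hT
  have htop : (LinearMap.range f).submoduleOf T = ⊤ := by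
    obtain ⟨_, _⟩ := isFiniteLength_iff_isNoetherian_isArtinian.mp hTfl
    by_contra hne
    have h1 := Submodule.length_lt hne
    rw [(Submodule.submoduleOfEquivOfLe hrT).length_eq, ← f.quotKerEquivRange.length_eq] at h1
    exact absurd hT (not_le.mpr h1)
  have hxT : x ∈ T := (Submodule.mem_torsionBySet_iff _ _).mpr fun c => hx c c.2
  have : (⟨x, hxT⟩ : T) ∈ (LinearMap.range f).submoduleOf T := htop ▸ trivial
  exact this

/-- The injective hull of the residue field is a cogenerator. -/
theorem IsInjectiveHull.exists_hom_ne_zero (hι : IsInjectiveHull ι) {M : Type u} [AddCommGroup M]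
    [Module A M] {x : M} (hx : x ≠ 0) : ∃ g : M →ₗ[A] E, g x ≠ 0 := by
  obtain ⟨g, hg⟩ := hι.injective_module.exists_comp_eq
    (LinearMap.toSpanSingleton A M x) (LinearMap.toSpanSingleton A E (ι 1)) (by
      intro r hr
      by_cases hu : IsUnit r
      · exact absurd (hu.smul_eq_zero.mp hr) hx
      · exact smul_one_eq_zero ι ((mem_maximalIdeal r).mpr hu))
  have h1 := hg 1
  simp only [LinearMap.toSpanSingleton_apply, one_smul] at h1
  exact ⟨g, h1 ▸ hι.map_one_ne_zero⟩

/-- The double annihilator property of the injective hull of the residue field. -/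
theorem IsInjectiveHull.exists_torsion_smul_ne_zero (hι : IsInjectiveHull ι) (I : Ideal A) {a : A}
    (ha : a ∉ I) : ∃ x : E, (∀ b ∈ I, b • x = 0) ∧ a • x ≠ 0 := by
  obtain ⟨g, hg⟩ := hι.exists_hom_ne_zero (x := Ideal.Quotient.mk I a)
    (mt Ideal.Quotient.eq_zero_iff_mem.mp ha)
  have hmk : ∀ b : A, b • (1 : A ⧸ I) = Ideal.Quotient.mk I b := fun b => by
    rw [Algebra.smul_def, mul_one]; rfl
  refine ⟨g 1, fun b hb => ?_, ?_⟩
  · rw [← map_smul, hmk, Ideal.Quotient.eq_zero_iff_mem.mpr hb, map_zero]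
  · rwa [← map_smul, hmk]

end Hull

/-! ### The top local cohomology module -/

section LocalCohomology

open IsLocalRing

variable {W : Type u} [CommRing W] [IsLocalRing W] [IsNoetherianRing W] (p : ℕ) [Fact p.Prime]
  [CharP W p] {h : ℕ} {y : Fin h → W}

/-- A model `D` of the top local cohomology module of a regular local ring with parameters `y`:
`δ s a` is the class of the fraction `a / (∏ y_i) ^ s`, and `F` is the Frobenius. -/
structure IsLocalCohomology (p : ℕ) (y : Fin h → W) {D : Type u} [AddCommGroup D] [Module W D]
    (δ : ℕ → W →ₗ[W] D) (F : D →+ D) : Prop where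
  eq_zero_iff : ∀ s a, δ s a = 0 ↔ a ∈ powIdeal y fun _ => s
  succ : ∀ s a, δ (s + 1) (a * ∏ i, y i) = δ s a
  exists_eq : ∀ z, ∃ s a, δ s a = z
  frobenius : ∀ s a, F (δ s a) = δ (p * s) (a ^ p)

/-- `D` is `W[1/Y]`, with `Y = ∏ y i`, modulo the fractions `a / Y ^ s` with `a ∈ (y_i ^ s)`, and
`F` is induced by the `p`-th power. That no further class becomes zero is the injectivity of the
transition maps. -/
theorem exists_isLocalCohomology (hflat : ∀ e, EqFlatPow W (p ^ e))
    (hy : Ideal.span (Set.range y) = maximalIdeal W)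
    (hmin : ∀ a : Fin h → W, ∑ i, a i * y i = 0 → ∀ i, a i ∈ maximalIdeal W) :
    ∃ (D : Type u) (_ : AddCommGroup D) (_ : Module W D) (δ : ℕ → W →ₗ[W] D) (F : D →+ D),
      IsLocalCohomology p y δ F := by
  set Y := ∏ i, y i with hY
  let L := Localization.Away Y
  have hYu : ∀ s, IsUnit (algebraMap W L (Y ^ s)) := fun s => by
    rw [map_pow]; exact (IsLocalization.Away.algebraMap_isUnit Y).pow s
  have hcancel : ∀ s (z z' : L), z * algebraMap W L (Y ^ s) = z' * algebraMap W L (Y ^ s) → z = z' :=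
    fun s z z' h => (hYu s).mul_right_cancel h
  have hmulY : ∀ s t a, a ∈ powIdeal y (fun _ => s) → a * Y ^ t ∈ powIdeal y (fun _ => s + t) := by
    intro s t a ha
    refine Submodule.span_induction (p := fun x _ => x * Y ^ t ∈ powIdeal y (fun _ => s + t))
        ?_ ?_ ?_ ?_ ha
    · rintro _ ⟨i, rfl⟩
      have : Y = y i * ∏ j ∈ Finset.univ.erase i, y j :=
        (Finset.mul_prod_erase _ _ (Finset.mem_univ i)).symm
      beta_reduce
      rw [this, mul_pow, ← mul_assoc, ← pow_add]
      exact Ideal.mul_mem_right _ _ (pow_mem_powIdeal y _ i le_rfl)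
    · simp
    · intro u v _ _ hu hv
      rw [add_mul]; exact add_mem hu hv
    · intro c u _ hu
      rw [smul_eq_mul, mul_assoc]; exact Ideal.mul_mem_left _ _ hu
  let N : Submodule W L :=
    { carrier := {z | ∃ s, ∃ a ∈ powIdeal y (fun _ => s), z * algebraMap W L (Y ^ s) = algebraMap W L a}
      zero_mem' := ⟨0, 0, zero_mem _, by simp⟩
      add_mem' := by
        rintro z z' ⟨s, a, ha, h⟩ ⟨s', a', ha', h'⟩
        refine ⟨s + s', a * Y ^ s' + a' * Y ^ s, add_mem (hmulY _ _ _ ha) ?_, ?_⟩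
        · rw [add_comm s s']; exact hmulY _ _ _ ha'
        · rw [map_add, map_mul, map_mul, ← h, ← h', pow_add, map_mul]
          ring
      smul_mem' := by
        rintro c z ⟨s, a, ha, h⟩
        refine ⟨s, c * a, Ideal.mul_mem_left _ _ ha, ?_⟩
        rw [map_mul, ← h, Algebra.smul_def, mul_assoc] }
  let v : ℕ → L := fun s => ↑(hYu s).unit⁻¹
  have hv : ∀ s, v s * algebraMap W L (Y ^ s) = 1 := fun s => (hYu s).val_inv_mul
  let δ : ℕ → W →ₗ[W] L ⧸ N := fun s => N.mkQ ∘ₗ LinearMap.toSpanSingleton W L (v s)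
  have hδ : ∀ s a, δ s a = N.mkQ (a • v s) := fun s a => rfl
  -- If `Y` were nilpotent, cancelling a vanishing power of it would put `1` in the maximal ideal.
  have hnt : Nontrivial L := by
    refine nontrivial_of_ne (algebraMap W L 1) (algebraMap W L 0) fun h01 => ?_
    obtain ⟨⟨_, r, rfl⟩, hr⟩ := (IsLocalization.eq_iff_exists (Submonoid.powers Y) L).mp h01
    have h1 : (1 : W) ∈ powIdeal y fun _ => 1 := by
      refine mem_powIdeal_of_mul_prod_pow p hflat hy hmin 1 r 1 ?_
      have : Y ^ r = 0 := by simpa using hr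
      rw [← hY, this, mul_zero]
      exact zero_mem _
    simp only [powIdeal, pow_one] at h1
    rw [hy] at h1
    exact (Ideal.ne_top_iff_one _).mp (Ideal.IsPrime.ne_top') h1
  have hchar : CharP L p := by
    refine (CharP.charP_iff_prime_eq_zero Fact.out).mpr ?_
    rw [← map_natCast (algebraMap W L), CharP.cast_eq_zero, map_zero]
  let Fr : L →+ L := (frobenius L p : L →+ L)
  have hFr : ∀ z, Fr z = z ^ p := fun z => rfl
  have hpow : ∀ s a, a ∈ powIdeal y (fun _ => s) → a ^ p ∈ powIdeal y (fun _ => s * p) := by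
    intro s a ha
    refine Submodule.span_induction (p := fun x _ => x ^ p ∈ powIdeal y (fun _ => s * p))
        ?_ ?_ ?_ ?_ ha
    · rintro _ ⟨i, rfl⟩
      beta_reduce
      rw [← pow_mul]
      exact pow_mem_powIdeal y _ i le_rfl
    · simp [(Fact.out : p.Prime).ne_zero]
    · intro u v _ _ hu hv
      rw [add_pow_char]; exact add_mem hu hv
    · intro c u _ hu
      rw [smul_eq_mul, mul_pow]; exact Ideal.mul_mem_left _ _ hu
  let F : L ⧸ N →+ L ⧸ N := QuotientAddGroup.map N.toAddSubgroup N.toAddSubgroup Fr (by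
    rintro z ⟨s, a, ha, h⟩
    refine ⟨s * p, a ^ p, hpow s a ha, ?_⟩
    rw [hFr, pow_mul, map_pow, ← mul_pow, h, map_pow])
  have hF : ∀ z, F (N.mkQ z) = N.mkQ (z ^ p) := fun z => rfl
  refine ⟨L ⧸ N, inferInstance, inferInstance, δ, F, ?_, ?_, ?_, ?_⟩
  · intro s a
    rw [hδ, Submodule.mkQ_apply, Submodule.Quotient.mk_eq_zero]
    constructor
    · rintro ⟨t, b, hb, hz⟩
      have h1 : algebraMap W L (a * Y ^ t) = algebraMap W L (b * Y ^ s) := by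
        rw [map_mul, map_mul, ← hz, Algebra.smul_def]
        linear_combination (- algebraMap W L a * algebraMap W L (Y ^ t)) * hv s
      obtain ⟨⟨_, r, rfl⟩, hr⟩ := (IsLocalization.eq_iff_exists (Submonoid.powers Y) L).mp h1
      refine mem_powIdeal_of_mul_prod_pow p hflat hy hmin s (t + r) a ?_
      have h2 := hmulY t (s + r) b hb
      rw [show t + (s + r) = s + (t + r) by ring] at h2
      convert h2 using 1
      simp only at hr
      rw [← hY, pow_add, pow_add]
      linear_combination hr
    · intro ha
      refine ⟨s, a, ha, ?_⟩
      rw [Algebra.smul_def, mul_assoc, hv, mul_one]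
  · intro s a
    rw [hδ, hδ]
    congr 1
    refine hcancel (s + 1) _ _ ?_
    rw [Algebra.smul_def, mul_assoc, hv, Algebra.smul_def, pow_succ, map_mul, map_mul]
    linear_combination (- algebraMap W L a * algebraMap W L Y) * hv s
  · intro z
    obtain ⟨z, rfl⟩ := N.mkQ_surjective z
    obtain ⟨a, ⟨_, s, rfl⟩, rfl⟩ := IsLocalization.exists_mk'_eq (Submonoid.powers Y) z
    refine ⟨s, a, ?_⟩
    rw [hδ]
    congr 1
    refine hcancel s _ _ ?_
    rw [Algebra.smul_def, mul_assoc, hv, mul_one]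
    exact (IsLocalization.mk'_spec L a (⟨Y ^ s, ⟨s, rfl⟩⟩ : Submonoid.powers Y)).symm
  · intro s a
    rw [hδ, hF, hδ]
    congr 1
    refine hcancel (p * s) _ _ ?_
    rw [Algebra.smul_def, Algebra.smul_def, mul_assoc _ (v (p * s)), hv, mul_pow, mul_assoc, mul_comm p s,
      pow_mul, map_pow, ← mul_pow, hv, one_pow, map_pow]

end LocalCohomology

/-! ### Top local cohomology as an injective hull of the residue field -/

section LocalCohomology

open IsLocalRing

variable {W : Type u} [CommRing W] {p : ℕ}
  {h : ℕ} {y : Fin h → W}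

theorem exists_pow_le_powIdeal [IsLocalRing W] [IsNoetherianRing W]
    (hy : Ideal.span (Set.range y) = maximalIdeal W) (s : Fin h → ℕ) :
    ∃ N, maximalIdeal W ^ N ≤ powIdeal y s := by
  refine Ideal.exists_pow_le_of_le_radical_of_fg ?_ (maximalIdeal W).fg_of_isNoetherianRing
  rw [← hy]
  refine Ideal.span_le.mpr ?_
  rintro _ ⟨i, rfl⟩
  exact ⟨s i, pow_mem_powIdeal y s i le_rfl⟩

theorem powIdeal_le_pow [IsLocalRing W] (hy : Ideal.span (Set.range y) = maximalIdeal W) (s : ℕ) :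
    powIdeal y (fun _ => s) ≤ maximalIdeal W ^ s := by
  refine Ideal.span_le.mpr ?_
  rintro _ ⟨i, rfl⟩
  refine Ideal.pow_mem_pow ?_ s
  rw [← hy]
  exact Ideal.subset_span ⟨i, rfl⟩

namespace IsLocalCohomology

variable {D : Type u} [AddCommGroup D] [Module W D] {δ : ℕ → W →ₗ[W] D} {F : D →+ D}
  (H : IsLocalCohomology p y δ F)

include H

theorem add (s t : ℕ) (a : W) : δ (s + t) (a * (∏ i, y i) ^ t) = δ s a := by
  induction t with
  | zero => simp
  | succ t ih => rw [pow_succ, ← mul_assoc, ← add_assoc, H.succ, ih]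

theorem exists_eq_of_le (z : D) (S : ℕ) : ∃ s ≥ S, ∃ a, δ s a = z := by
  obtain ⟨s, a, rfl⟩ := H.exists_eq z
  exact ⟨s + S, Nat.le_add_left _ _, _, H.add s S a⟩

theorem smul_eq_zero (s : ℕ) (a w : W) (hw : w ∈ powIdeal y fun _ => s) : w • δ s a = 0 := by
  rw [← map_smul, H.eq_zero_iff]
  exact Ideal.mul_mem_right _ _ hw

theorem frobenius_pow (e s : ℕ) (a : W) :
    F^[e] (δ s a) = δ (p ^ e * s) (a ^ p ^ e) := by
  induction e with
  | zero => simp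
  | succ e ih =>
    rw [Function.iterate_succ_apply', ih, H.frobenius, ← mul_assoc, ← pow_succ', ← pow_mul,
      ← pow_succ]

theorem frobenius_pow_smul (e : ℕ) (w : W) (z : D) : F^[e] (w • z) = w ^ p ^ e • F^[e] z := by
  obtain ⟨s, a, rfl⟩ := H.exists_eq z
  rw [← map_smul, H.frobenius_pow, H.frobenius_pow, ← map_smul, smul_eq_mul, smul_eq_mul, mul_pow]

variable [IsLocalRing W] (hy : Ideal.span (Set.range y) = maximalIdeal W)

include hy

theorem delta_one_eq_zero_iff (a : W) : δ 1 a = 0 ↔ a ∈ maximalIdeal W := by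
  rw [H.eq_zero_iff]
  simp only [powIdeal, pow_one]
  rw [hy]

theorem delta_one_one_ne_zero : δ 1 1 ≠ 0 := fun h0 =>
  (Ideal.ne_top_iff_one _).mp (Ideal.IsPrime.ne_top') ((H.delta_one_eq_zero_iff hy 1).mp h0)

variable [IsNoetherianRing W]

theorem exists_pow_smul_eq_zero (z : D) : ∃ N, ∀ w ∈ maximalIdeal W ^ N, w • z = 0 := by
  obtain ⟨s, a, rfl⟩ := H.exists_eq z
  obtain ⟨N, hN⟩ := exists_pow_le_powIdeal hy fun _ => s
  exact ⟨N, fun w hw => H.smul_eq_zero s a w (hN hw)⟩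

variable [Fact p.Prime] [CharP W p] (hflat : ∀ e, EqFlatPow W (p ^ e))
  (hmin : ∀ a : Fin h → W, ∑ i, a i * y i = 0 → ∀ i, a i ∈ maximalIdeal W)

include hflat hmin

/-- `D` is an essential extension of the residue field. -/
theorem exists_smul_eq {z : D} (hz : z ≠ 0) : ∃ w : W, w • z = δ 1 1 := by
  classical
  have hex := H.exists_pow_smul_eq_zero hy z
  have hspec := Nat.find_spec hex
  have hmin' : ∀ N, N < Nat.find hex → ¬ _ := fun N hN => Nat.find_min hex hN
  obtain hN | ⟨N, hN⟩ : Nat.find hex = 0 ∨ ∃ N, Nat.find hex = N + 1 := by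
    cases Nat.find hex
    exacts [Or.inl rfl, Or.inr ⟨_, rfl⟩]
  · rw [hN] at hspec
    exact absurd (by simpa using hspec 1 (by simp)) hz
  · have := hmin' N (by omega)
    push Not at this
    obtain ⟨w, hw, hw0⟩ := this
    obtain ⟨s, hs, b, hb⟩ := H.exists_eq_of_le (w • z) 1
    obtain ⟨s, rfl⟩ := Nat.exists_eq_add_of_le' hs
    -- `w • z` is nonzero and killed by the maximal ideal, because the exponent `N + 1` is the least
    -- one annihilating `z`. So its numerator is a multiple of `(∏ y i) ^ s` and the class is `c • δ
    -- 1 1`.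
    obtain ⟨c, hc⟩ := exists_sub_mem_powIdeal p hflat hy hmin s b fun i => by
      rw [← H.eq_zero_iff, mul_comm, ← smul_eq_mul, map_smul, hb, ← mul_smul]
      refine hspec _ ?_
      rw [hN, pow_succ']
      refine Ideal.mul_mem_mul ?_ hw
      rw [← hy]
      exact Ideal.subset_span ⟨i, rfl⟩
    rw [← H.eq_zero_iff, map_sub, sub_eq_zero, hb, add_comm s 1, H.add] at hc
    have hu : IsUnit c := by
      by_contra h
      exact hw0 (by rw [hc, H.delta_one_eq_zero_iff hy]; exact (mem_maximalIdeal c).mpr h)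
    obtain ⟨v, hv⟩ := hu.exists_left_inv
    exact ⟨v * w, by rw [mul_smul, hc, ← map_smul, smul_eq_mul, hv]⟩

/-- `D` is an injective hull of the residue field. -/
theorem exists_isInjectiveHull : ∃ ι : ResidueField W →ₗ[W] D, IsInjectiveHull ι := by
  have hess : ∀ {z : D}, z ≠ 0 → ∃ w : W, w • z = δ 1 1 := H.exists_smul_eq hy hflat hmin
  obtain ⟨E, _, _, ι, hι⟩ := _root_.exists_isInjectiveHull W (ResidueField W)
  let j : ResidueField W →ₗ[W] D := (maximalIdeal W).liftQ (δ 1)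
    fun w hw => (H.delta_one_eq_zero_iff hy w).mpr hw
  have hj : ∀ w, j (residue W w) = δ 1 w := fun w => rfl
  have hjinj : Function.Injective j := by
    rw [injective_iff_map_eq_zero]
    intro x hx
    obtain ⟨w, rfl⟩ := residue_surjective x
    rw [hj, H.delta_one_eq_zero_iff hy] at hx
    exact (residue_eq_zero_iff w).mpr hx
  obtain ⟨g, hg⟩ := hι.injective_module.exists_comp_eq j ι (by
    rw [LinearMap.ker_eq_bot.mpr hjinj]; exact bot_le)
  have hg1 : g (δ 1 1) = ι 1 := hg 1
  have hginj : Function.Injective g := by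
    rw [injective_iff_map_eq_zero]
    intro z hz
    by_contra h0
    obtain ⟨w, hw⟩ := hess h0
    refine hι.map_one_ne_zero ?_
    rw [← hg1, ← hw, map_smul, hz, smul_zero]
  -- An element of the abstract hull is killed by some `𝔪 ^ s`, hence by the kernel `(y_i ^ s)` of
  -- `g ∘ δ s`. By the length comparison it lies in the image of that map.
  have hgsurj : Function.Surjective g := by
    intro x
    obtain ⟨s, hs⟩ := hι.exists_pow_smul_eq_zero x
    obtain ⟨N, hN⟩ := exists_pow_le_powIdeal hy fun _ => s
    have hker : ∀ w, w ∈ LinearMap.ker (g ∘ₗ δ s) ↔ w ∈ powIdeal y fun _ => s := fun w => by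
      rw [LinearMap.mem_ker, LinearMap.comp_apply, map_eq_zero_iff g hginj, H.eq_zero_iff]
    obtain ⟨w, hw⟩ := hι.mem_range_of_ker (g ∘ₗ δ s) (fun w hw => (hker w).mpr (hN hw))
      (x := x) fun w hw => hs w (powIdeal_le_pow hy s ((hker w).mp hw))
    exact ⟨δ s w, hw⟩
  let e : E ≃ₗ[W] D := (LinearEquiv.ofBijective g ⟨hginj, hgsurj⟩).symm
  refine ⟨j, Module.Baer.injective (Module.Baer.of_equiv e
    (Module.Baer.of_injective hι.injective_module)), hjinj, fun N hN => ?_⟩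
  obtain ⟨z, hz, hz0⟩ := Submodule.exists_mem_ne_zero_of_ne_bot hN
  obtain ⟨w, hw⟩ := hess hz0
  exact (Submodule.ne_bot_iff _).mpr ⟨w • z, ⟨N.smul_mem w hz, 1, hw.symm⟩,
    hw ▸ H.delta_one_one_ne_zero hy⟩

/-- `δ s` has kernel `(y_i ^ s)`, so the length comparison in the hull `D` applies. Elements of
bounded torsion thereby get a common denominator. -/
theorem exists_delta_eq {z : D} {s : ℕ} (hz : ∀ w ∈ powIdeal y (fun _ => s), w • z = 0) :
    ∃ a, δ s a = z := by
  obtain ⟨ι, hι⟩ := H.exists_isInjectiveHull hy hflat hmin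
  obtain ⟨N, hN⟩ := exists_pow_le_powIdeal hy fun _ => s
  exact hι.mem_range_of_ker (δ s) (fun w hw => (H.eq_zero_iff s w).mpr (hN hw))
    fun w hw => hz w ((H.eq_zero_iff s w).mp hw)

end IsLocalCohomology

end LocalCohomology

/-! ### Frobenius powers -/

section FrobeniusPower

variable {W : Type u} [CommRing W] {p : ℕ}

theorem frobeniusPower_mono (e : ℕ) {I J : Ideal W} (h : I ≤ J) :
    frobeniusPower p e I ≤ frobeniusPower p e J :=
  Ideal.span_mono fun _ ⟨a, ha, hb⟩ => ⟨a, h ha, hb⟩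

theorem pow_mem_frobeniusPower (e : ℕ) {I : Ideal W} {a : W} (ha : a ∈ I) :
    a ^ p ^ e ∈ frobeniusPower p e I :=
  Ideal.subset_span ⟨a, ha, rfl⟩

theorem exists_sum_of_mem_frobeniusPower {e : ℕ} {I : Ideal W} {x : W}
    (hx : x ∈ frobeniusPower p e I) :
    ∃ (l : ℕ) (c b : Fin l → W), (∀ j, b j ∈ I) ∧ x = ∑ j, c j * b j ^ p ^ e := by
  obtain ⟨l, c, g, hg⟩ := Submodule.mem_span_set'.mp hx
  choose b hb hb' using fun j => (g j).2
  refine ⟨l, c, b, hb, ?_⟩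
  rw [← hg]
  exact Finset.sum_congr rfl fun j _ => by rw [smul_eq_mul, hb' j]

theorem frobeniusPower_sup_le [Fact p.Prime] [CharP W p] (e : ℕ) (I J : Ideal W) :
    frobeniusPower p e (I ⊔ J) ≤ frobeniusPower p e I ⊔ frobeniusPower p e J := by
  refine Ideal.span_le.mpr ?_
  rintro _ ⟨a, ha, rfl⟩
  obtain ⟨x, hx, z, hz, rfl⟩ := Submodule.mem_sup.mp ha
  rw [add_pow_char_pow]
  exact add_mem (Ideal.mem_sup_left (pow_mem_frobeniusPower e hx))
    (Ideal.mem_sup_right (pow_mem_frobeniusPower e hz))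

theorem frobeniusPower_le_pow [Fact p.Prime] (e : ℕ) {I 𝔪 : Ideal W} {s : ℕ} (h : I ≤ 𝔪 ^ s) :
    frobeniusPower p e I ≤ 𝔪 ^ s := by
  refine Ideal.span_le.mpr ?_
  rintro _ ⟨a, ha, rfl⟩
  exact Ideal.pow_mem_of_mem _ (h ha) _ (pow_pos (Fact.out : p.Prime).pos e)

/-- If the Frobenius is flat, Frobenius powers commute with intersections. -/
theorem EqFlatPow.inf_frobeniusPower_le [Fact p.Prime] [CharP W p] {e : ℕ}
    (hflat : EqFlatPow W (p ^ e)) (I J : Ideal W) :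
    frobeniusPower p e I ⊓ frobeniusPower p e J ≤ frobeniusPower p e (I ⊓ J) := by
  rintro x ⟨hI, hJ⟩
  obtain ⟨l, c, b, hb, hx⟩ := exists_sum_of_mem_frobeniusPower hI
  obtain ⟨l', c', b', hb', hx'⟩ := exists_sum_of_mem_frobeniusPower hJ
  -- Flatness is applied to the difference of the two expressions for `x`; the `I`-part of each
  -- resulting relation equals minus its `J`-part, and so lies in `I ⊓ J`.
  obtain ⟨m, d, r, h1, h2⟩ := hflat.exists_of_fintype (Sum.elim b b') (Sum.elim c fun j => - c' j)
    (by simp [← hx, ← hx'])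
  have hinl := fun i => h1 (Sum.inl i)
  simp only [Sum.elim_inl] at hinl
  have hx2 : x = ∑ j, d j * (∑ i, r j (Sum.inl i) * b i) ^ p ^ e := by
    rw [hx]
    simp only [sum_pow_char_pow, mul_pow, Finset.mul_sum]
    rw [Finset.sum_comm]
    refine Finset.sum_congr rfl fun i _ => ?_
    rw [hinl i, Finset.sum_mul]
    exact Finset.sum_congr rfl fun j _ => by ring
  rw [hx2]
  refine Ideal.sum_mem _ fun j _ => Ideal.mul_mem_left _ _ (pow_mem_frobeniusPower e ⟨?_, ?_⟩)
  · exact Ideal.sum_mem _ fun i _ => Ideal.mul_mem_left _ _ (hb i)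
  · have := h2 j
    rw [Fintype.sum_sum_type] at this
    simp only [Sum.elim_inl, Sum.elim_inr] at this
    rw [eq_neg_of_add_eq_zero_left this]
    exact neg_mem (Ideal.sum_mem _ fun i _ => Ideal.mul_mem_left _ _ (hb' i))

/-- If the Frobenius is flat, Frobenius powers commute with colon ideals. -/
theorem EqFlatPow.mem_frobeniusPower_of_mul_pow_mem {e : ℕ}
    (hflat : EqFlatPow W (p ^ e)) (I K : Ideal W) (b w : W) (hK : ∀ v, v * b ∈ I → v ∈ K)
    (h : w * b ^ p ^ e ∈ frobeniusPower p e I) : w ∈ frobeniusPower p e K := by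
  obtain ⟨l, c, k, hk, hx⟩ := exists_sum_of_mem_frobeniusPower h
  obtain ⟨m, d, r, h1, h2⟩ := hflat.exists_of_fintype (ι := Unit ⊕ Fin l)
    (Sum.elim (fun _ => b) k) (Sum.elim (fun _ => w) fun j => - c j) (by simp [← hx])
  have hw := h1 (Sum.inl ())
  simp only [Sum.elim_inl] at hw
  rw [hw]
  refine Ideal.sum_mem _ fun j _ => Ideal.mul_mem_left _ _ (pow_mem_frobeniusPower e (hK _ ?_))
  have := h2 j
  rw [Fintype.sum_sum_type] at this
  simp only [Sum.elim_inl, Sum.elim_inr, Finset.univ_unique, Finset.sum_singleton] at this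
  rw [show (default : Unit) = () from rfl] at this
  rw [eq_neg_of_add_eq_zero_left this]
  exact neg_mem (Ideal.sum_mem _ fun i _ => Ideal.mul_mem_left _ _ (hk i))

/-- `K` is the intersection of the colons `(I : b)` for `b ∈ B`; Frobenius powers commute with each
colon and with the intersections. -/
theorem EqFlatPow.mem_frobeniusPower_of_finset [Fact p.Prime] [CharP W p] {e : ℕ}
    (hflat : EqFlatPow W (p ^ e)) (I : Ideal W) (B : Finset W) (w : W)
    (h : ∀ b ∈ B, w * b ^ p ^ e ∈ frobeniusPower p e I) :
    ∃ K : Ideal W, w ∈ frobeniusPower p e K ∧ ∀ v ∈ K, ∀ b ∈ B, v * b ∈ I := by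
  classical
  induction B using Finset.induction_on with
  | empty =>
    refine ⟨⊤, ?_, by simp⟩
    have : (1 : W) ^ p ^ e ∈ frobeniusPower p e (⊤ : Ideal W) := pow_mem_frobeniusPower e trivial
    rw [one_pow] at this
    rw [(Ideal.eq_top_iff_one _).mpr this]
    trivial
  | insert b B hb ih =>
    obtain ⟨K, hK, hK'⟩ := ih fun b' hb' => h b' (Finset.mem_insert_of_mem hb')
    refine ⟨I.colon {b} ⊓ K, hflat.inf_frobeniusPower_le _ _ ⟨?_, hK⟩, ?_⟩
    · exact hflat.mem_frobeniusPower_of_mul_pow_mem I _ b w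
        (fun v hv => Submodule.mem_colon_singleton.mpr hv) (h b (Finset.mem_insert_self _ _))
    · rintro v ⟨hv, hv'⟩ b' hb'
      obtain rfl | hb' := Finset.mem_insert.mp hb'
      · exact Submodule.mem_colon_singleton.mp hv
      · exact hK' v hv' b' hb'

/-- Artin–Rees for colon ideals. -/
theorem exists_mem_colon_sup_pow [IsNoetherianRing W] (𝔪 K : Ideal W) (G : Ideal W) (n : ℕ) :
    ∃ M, ∀ w, (∀ g ∈ G, w * g ∈ K ⊔ 𝔪 ^ M) → w ∈ K.colon (G : Set W) ⊔ 𝔪 ^ n := by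
  obtain ⟨r, g, hg⟩ := Submodule.fg_iff_exists_fin_generating_family.mp (IsNoetherian.noetherian G)
  -- Multiplication by the generators of `G`, with kernel `(K : G)`. Artin–Rees for its range lifts
  -- values of high order to arguments of order `n`.
  let L : W →ₗ[W] (Fin r → W ⧸ K) :=
    LinearMap.pi fun i => LinearMap.toSpanSingleton W (W ⧸ K) (Ideal.Quotient.mk K (g i))
  have hL : ∀ w i, L w i = Ideal.Quotient.mk K (w * g i) := fun w i => by
    change w • Ideal.Quotient.mk K (g i) = _
    rw [Algebra.smul_def, map_mul]; rfl
  obtain ⟨c, hc⟩ := 𝔪.exists_pow_inf_eq_pow_smul (LinearMap.range L)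
  refine ⟨n + c, fun w hw => ?_⟩
  have h1 : L w ∈ (𝔪 ^ (n + c) • ⊤ ⊓ LinearMap.range L : Submodule W (Fin r → W ⧸ K)) := by
    refine ⟨?_, w, rfl⟩
    rw [pi_eq_sum_univ (L w)]
    have hgi : ∀ i, g i ∈ G := fun i => hg ▸ Submodule.subset_span ⟨i, rfl⟩
    have : ∀ i, ∃ z ∈ 𝔪 ^ (n + c), L w i = z • (1 : W ⧸ K) := fun i => by
      obtain ⟨x, hx, z, hz, hxz⟩ := Submodule.mem_sup.mp (hw _ (hgi i))
      refine ⟨z, hz, ?_⟩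
      rw [hL, ← hxz, map_add, Ideal.Quotient.eq_zero_iff_mem.mpr hx, zero_add, Algebra.smul_def,
        mul_one]
      rfl
    choose z hz hz' using this
    have h2 : L w = ∑ i, z i • (Pi.single i (1 : W ⧸ K) : Fin r → W ⧸ K) := by
      funext j
      rw [Finset.sum_apply, Finset.sum_eq_single j]
      · simp [hz']
      · intro i _ hij
        simp [Pi.single_eq_of_ne hij.symm]
      · simp
    rw [← pi_eq_sum_univ (L w), h2]
    exact Submodule.sum_mem _ fun i _ => Submodule.smul_mem_smul (hz i) trivial
  rw [hc _ (by omega), Nat.add_sub_cancel] at h1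
  have h2 := Submodule.smul_mono (le_refl (𝔪 ^ n)) inf_le_right h1
  rw [LinearMap.range_eq_map, ← Submodule.map_smul''] at h2
  obtain ⟨v, hv, hvw⟩ := h2
  have hv : v ∈ 𝔪 ^ n := by simpa using hv
  refine Submodule.mem_sup.mpr ⟨w - v, ?_, v, hv, by ring⟩
  have hker : ∀ i, (w - v) * g i ∈ K := fun i => by
    rw [← Ideal.Quotient.eq_zero_iff_mem, ← hL, map_sub, hvw, sub_self]; rfl
  rw [Submodule.mem_colon]
  intro x hx
  have hx' : x ∈ Submodule.span W (Set.range g) := hg ▸ hx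
  clear hx
  induction hx' using Submodule.span_induction with
  | mem x hx => obtain ⟨i, rfl⟩ := hx; exact hker i
  | zero => simp
  | add x y _ _ hx hy => rw [smul_add]; exact add_mem hx hy
  | smul c x _ hx => rw [smul_comm]; exact Ideal.mul_mem_left _ _ hx

end FrobeniusPower

/-! ### Frobenius actions on torsion submodules of the top local cohomology -/

section Fedder

open IsLocalRing

variable {W : Type u} [CommRing W] [IsLocalRing W] [IsNoetherianRing W] {p : ℕ} [Fact p.Prime]
  [CharP W p] {h : ℕ} {y : Fin h → W} {D : Type u} [AddCommGroup D] [Module W D]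
  {δ : ℕ → W →ₗ[W] D} {F : D →+ D} (H : IsLocalCohomology p y δ F)
  (hy : Ideal.span (Set.range y) = maximalIdeal W) (hflat : ∀ e, EqFlatPow W (p ^ e))
  (hmin : ∀ a : Fin h → W, ∑ i, a i * y i = 0 → ∀ i, a i ∈ maximalIdeal W)

include H

omit [IsLocalRing W] [IsNoetherianRing W] [Fact p.Prime] [CharP W p] in
theorem IsLocalCohomology.smul_frobenius_eq_zero {e : ℕ} {I : Ideal W} {w : W} {z : D}
    (hw : w ∈ frobeniusPower p e I) (hz : ∀ v ∈ I, v • z = 0) : w • F^[e] z = 0 := by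
  obtain ⟨l, c, b, hb, rfl⟩ := exists_sum_of_mem_frobeniusPower hw
  rw [Finset.sum_smul]
  refine Finset.sum_eq_zero fun j _ => ?_
  rw [mul_smul, ← H.frobenius_pow_smul, hz _ (hb j), iterate_map_zero, smul_zero]

include hy hflat hmin

/-- The annihilator of the Frobenius image of the `I`-torsion is the Frobenius power of `I`. -/
theorem IsLocalCohomology.mem_frobeniusPower {e s : ℕ} {I : Ideal W} {w : W}
    (hI : powIdeal y (fun _ => s) ≤ I)
    (hw : ∀ z, (∀ v ∈ I, v • z = 0) → w • F^[e] z = 0) : w ∈ frobeniusPower p e I := by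
  -- The classes `δ s b` with `b ∈ ((y_i ^ s) : I)` are the `I`-torsion of `D`. Finitely many such
  -- `b` place `w` in `K^[q]` with `K ⊆ ((y_i ^ s) : ((y_i ^ s) : I))`, and this double colon is
  -- contained in `I` by duality.
  obtain ⟨B, hB⟩ := IsNoetherian.noetherian ((powIdeal y fun _ => s).colon (I : Set W))
  have hle : powIdeal y (fun _ => p ^ e * s) ≤ frobeniusPower p e (powIdeal y fun _ => s) := by
    refine Ideal.span_le.mpr ?_
    rintro _ ⟨i, rfl⟩
    beta_reduce
    rw [mul_comm, pow_mul]
    exact pow_mem_frobeniusPower e (pow_mem_powIdeal y _ i le_rfl)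
  obtain ⟨K, hK, hK'⟩ := (hflat e).mem_frobeniusPower_of_finset (powIdeal y fun _ => s) B w
    fun b hb => by
      have hbC : b ∈ (powIdeal y fun _ => s).colon (I : Set W) := hB ▸ Submodule.subset_span hb
      have := hw (δ s b) fun v hv => by
        rw [← map_smul, H.eq_zero_iff, smul_eq_mul, mul_comm]
        exact Submodule.mem_colon.mp hbC v hv
      rw [H.frobenius_pow, ← map_smul, H.eq_zero_iff] at this
      exact hle this
  refine frobeniusPower_mono e (fun v hv => ?_) hK
  by_contra hvI
  obtain ⟨ι, hι⟩ := H.exists_isInjectiveHull hy hflat hmin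
  obtain ⟨z, hz, hvz⟩ := hι.exists_torsion_smul_ne_zero I hvI
  obtain ⟨b, rfl⟩ := H.exists_delta_eq hy hflat hmin fun w hw => hz w (hI hw)
  have hBI : ∀ b ∈ Submodule.span W (B : Set W), v • b ∈ powIdeal y fun _ => s := by
    intro b hb
    induction hb using Submodule.span_induction with
    | mem x hx => exact hK' v hv x hx
    | zero => simp
    | add x y _ _ hx hy => rw [smul_add]; exact add_mem hx hy
    | smul c x _ hx => rw [smul_comm]; exact Ideal.mul_mem_left _ _ hx
  refine hvz ?_
  rw [← map_smul, H.eq_zero_iff]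
  refine hBI b ?_
  rw [hB, Submodule.mem_colon]
  intro x hx
  rw [smul_eq_mul, mul_comm, ← smul_eq_mul, ← H.eq_zero_iff, map_smul]
  exact hz x hx

variable {E : Type u} [AddCommGroup E] [Module W E] (θ : E →ₗ[W] D) (hθ : Function.Injective θ)

include hθ

/-- On elements of bounded torsion, a `p ^ e`-linear map is a multiple of the Frobenius. -/
theorem IsLocalCohomology.exists_eq_smul_frobenius (e : ℕ) (Φ : E →+ D)
    (hΦ : ∀ (w : W) x, Φ (w • x) = w ^ p ^ e • Φ x) (s : ℕ) :
    ∃ t : W, ∀ x, (∀ w ∈ powIdeal y (fun _ => s), w • x = 0) → Φ x = t • F^[e] (θ x) := by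
  classical
  obtain ⟨ι, hι⟩ := H.exists_isInjectiveHull hy hflat hmin
  let X := {x : E // ∀ w ∈ powIdeal y (fun _ => s), w • x = 0}
  have hX : ∀ x : X, ∃ a, δ s a = θ x := fun x =>
    H.exists_delta_eq hy hflat hmin fun w hw => by rw [← map_smul, x.2 w hw, map_zero]
  choose a ha using hX
  -- The assignment `F^e (θ x) ↦ Φ x` respects linear relations: flatness turns a relation among the
  -- `F^e (θ x)` into `q`-th powers of relations among the `x`, which `Φ` respects. Injectivity of
  -- `D` extends it to a linear map `g`.
  obtain ⟨g, hg⟩ := hι.injective_module.exists_comp_eq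
    (Finsupp.linearCombination W fun x : X => F^[e] (θ x))
    (Finsupp.linearCombination W fun x : X => Φ x) (by
      intro f hf
      rw [LinearMap.mem_ker, Finsupp.linearCombination_apply, Finsupp.sum] at hf ⊢
      rw [← Finset.sum_coe_sort] at hf ⊢
      have h0 : ∑ x : f.support, f x * a x ^ p ^ e ∈ powIdeal y fun _ => p ^ e * s := by
        rw [← H.eq_zero_iff, ← hf, map_sum]
        refine Finset.sum_congr rfl fun x _ => ?_
        rw [← ha, H.frobenius_pow, ← map_smul, smul_eq_mul]
      obtain ⟨v, hv⟩ := (Submodule.mem_span_range_iff_exists_fun W).mp h0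
      obtain ⟨m, c, b, h1, h2⟩ := (hflat e).exists_of_fintype (ι := f.support ⊕ Fin h)
        (Sum.elim (fun x => a x) fun i => y i ^ s) (Sum.elim (fun x => f x) fun i => - v i) (by
          simp only [Fintype.sum_sum_type, Sum.elim_inl, Sum.elim_inr]
          rw [← hv, ← Finset.sum_add_distrib]
          refine Finset.sum_eq_zero fun i _ => ?_
          rw [smul_eq_mul, ← pow_mul, mul_comm s]
          ring)
      have hinl := fun x => h1 (Sum.inl x)
      simp only [Sum.elim_inl] at hinl
      have hrel : ∀ j, ∑ x : f.support, b j (Sum.inl x) • ((x : X) : E) = 0 := by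
        intro j
        refine hθ ?_
        rw [map_zero, map_sum]
        have := h2 j
        rw [Fintype.sum_sum_type] at this
        simp only [Sum.elim_inl, Sum.elim_inr] at this
        have hsum : ∑ x : f.support, θ (b j (Sum.inl x) • ((x : X) : E)) =
            δ s (∑ x : f.support, b j (Sum.inl x) * a x) := by
          rw [map_sum]
          refine Finset.sum_congr rfl fun x _ => ?_
          rw [map_smul, ← ha, ← map_smul, smul_eq_mul]
        rw [hsum, H.eq_zero_iff, eq_neg_of_add_eq_zero_left this]
        exact neg_mem (Ideal.sum_mem _ fun i _ =>
          Ideal.mul_mem_left _ _ (pow_mem_powIdeal y _ i le_rfl))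
      calc ∑ x : f.support, f x • Φ (x : X)
          = ∑ x : f.support, ∑ j, c j • Φ (b j (Sum.inl x) • ((x : X) : E)) := by
            refine Finset.sum_congr rfl fun x _ => ?_
            rw [hinl x, Finset.sum_smul]
            refine Finset.sum_congr rfl fun j _ => ?_
            rw [mul_smul, hΦ]
        _ = ∑ j, c j • Φ (∑ x : f.support, b j (Sum.inl x) • ((x : X) : E)) := by
            rw [Finset.sum_comm]
            refine Finset.sum_congr rfl fun j _ => ?_
            rw [map_sum, Finset.smul_sum]
        _ = 0 := Finset.sum_eq_zero fun j _ => by rw [hrel, map_zero, smul_zero])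
  -- The `(y_i ^ (q s))`-torsion of `D` is cyclic, generated by `δ (q s) 1`, so on it `g` is
  -- multiplication by some `t`.
  obtain ⟨t, ht⟩ := H.exists_delta_eq hy hflat hmin (z := g (δ (p ^ e * s) 1))
    (s := p ^ e * s) fun w hw => by rw [← map_smul, H.smul_eq_zero _ _ _ hw, map_zero]
  refine ⟨t, fun x hx => ?_⟩
  have := hg (Finsupp.single ⟨x, hx⟩ 1)
  simp only [Finsupp.linearCombination_single, one_smul] at this
  rw [← this, ← ha ⟨x, hx⟩, H.frobenius_pow]
  generalize a ⟨x, hx⟩ ^ p ^ e = b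
  calc g (δ (p ^ e * s) b) = b • g (δ (p ^ e * s) 1) := by
        rw [← map_smul, ← map_smul, smul_eq_mul, mul_one]
    _ = t • δ (p ^ e * s) b := by
        rw [← ht, ← map_smul, ← map_smul, smul_eq_mul, smul_eq_mul, mul_comm b]

variable {J : Ideal W} (hrange : ∀ z, z ∈ LinearMap.range θ ↔ ∀ w ∈ J, w • z = 0)

include hrange

/-- On torsion of order `s + M` the map is `t F^e`. Since `φ` takes values in the `J`-torsion, `t J`
lies in `J^[q] + 𝔪 ^ M`, hence `t` lies in `(J^[q] : J) + 𝔪 ^ n`. The parts of `t` in `J^[q]` and in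
`𝔪 ^ n` act as zero on `F^e (θ x)` for the `x` in question, leaving a multiple of `u`. -/
theorem IsLocalCohomology.exists_eq_smul_mul_frobenius (e : ℕ) {u : W}
    (hu : frobeniusColon p e J ≤ frobeniusPower p e J ⊔ Ideal.span {u}) (φ : E →+ E)
    (hφ : ∀ (w : W) x, φ (w • x) = w ^ p ^ e • φ x) (s : ℕ) :
    ∃ c : W, ∀ x, (∀ w ∈ maximalIdeal W ^ s, w • x = 0) → θ (φ x) = (c * u) • F^[e] (θ x) := by
  -- `n` is chosen so that `𝔪 ^ n` kills the Frobenius image of `𝔪 ^ s`-torsion, and `M` is then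
  -- supplied by Artin–Rees for that `n`.
  obtain ⟨n, hn⟩ := exists_pow_le_powIdeal hy fun _ => p ^ e * s
  obtain ⟨M, hM⟩ := exists_mem_colon_sup_pow (maximalIdeal W) (frobeniusPower p e J) J n
  have hle := powIdeal_le_pow hy (s + M)
  obtain ⟨t, ht⟩ := H.exists_eq_smul_frobenius hy hflat hmin θ hθ e
    ((θ : E →+ D).comp φ) (fun w x => by simp [hφ]) (s + M)
  have htJ : t ∈ frobeniusPower p e J ⊔ Ideal.span {u} ⊔ maximalIdeal W ^ n := by
    have hcol : t ∈ frobeniusColon p e J ⊔ maximalIdeal W ^ n := by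
      refine hM t fun g hg => ?_
      have h1 : t * g ∈ frobeniusPower p e (J ⊔ powIdeal y fun _ => s + M) := by
        refine H.mem_frobeniusPower hy hflat hmin (s := s + M) le_sup_right fun z hz => ?_
        obtain ⟨x, rfl⟩ := (hrange z).mpr fun w hw => hz w (Ideal.mem_sup_left hw)
        have h2 : θ (φ x) = t • F^[e] (θ x) := ht x fun w hw => hθ (by
          rw [map_smul, hz w (Ideal.mem_sup_right hw), map_zero])
        rw [mul_comm, mul_smul, ← h2]
        exact (hrange _).mp ⟨φ x, rfl⟩ g hg
      have h3 : frobeniusPower p e (powIdeal y fun _ => s + M) ≤ maximalIdeal W ^ M :=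
        (frobeniusPower_le_pow e hle).trans (Ideal.pow_le_pow_right (by omega))
      exact (frobeniusPower_sup_le e _ _).trans (sup_le_sup_left h3 _) h1
    exact sup_le_sup_right hu (maximalIdeal W ^ n) hcol
  obtain ⟨v, hv, μ, hμ, htv⟩ := Submodule.mem_sup.mp htJ
  obtain ⟨κ, hκ, v', hv', hvv⟩ := Submodule.mem_sup.mp hv
  obtain ⟨c, hc⟩ := Ideal.mem_span_singleton'.mp hv'
  refine ⟨c, fun x hx => ?_⟩
  have h1 : θ (φ x) = t • F^[e] (θ x) :=
    ht x fun w hw => hx w (Ideal.pow_le_pow_right (Nat.le_add_right s M) (hle hw))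
  have hκ0 : κ • F^[e] (θ x) = 0 := H.smul_frobenius_eq_zero hκ ((hrange _).mp ⟨x, rfl⟩)
  have hμ0 : μ • F^[e] (θ x) = 0 := by
    obtain ⟨a, ha⟩ := H.exists_delta_eq hy hflat hmin (z := θ x) (s := s) fun w hw => by
      rw [← map_smul, hx w (powIdeal_le_pow hy s hw), map_zero]
    rw [← ha, H.frobenius_pow, H.smul_eq_zero _ _ μ (hn hμ)]
  rw [h1, ← htv, ← hvv, ← hc, add_smul, add_smul, hκ0, hμ0, zero_add, add_zero]

/-- Multipliers of `u F^e` that vanish on torsion elements of large order are close to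
multipliers that vanish on all elements. -/
theorem IsLocalCohomology.exists_mem_sup_pow (e : ℕ) (u : W) (n : ℕ) :
    ∃ s, ∀ w, (∀ x, (∀ v ∈ maximalIdeal W ^ s, v • x = 0) → (w * u) • F^[e] (θ x) = 0) →
      ∃ z, (∀ x, (z * u) • F^[e] (θ x) = 0) ∧ w - z ∈ maximalIdeal W ^ n := by
  obtain ⟨M, hM⟩ := exists_mem_colon_sup_pow (maximalIdeal W) (frobeniusPower p e J)
    (Ideal.span {u}) n
  obtain ⟨s, hs⟩ := exists_pow_le_powIdeal hy fun _ => M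
  refine ⟨s, fun w hw => ?_⟩
  have h1 : w * u ∈ frobeniusPower p e (J ⊔ powIdeal y fun _ => M) := by
    refine H.mem_frobeniusPower hy hflat hmin (s := M) le_sup_right fun z hz => ?_
    obtain ⟨x, rfl⟩ := (hrange z).mpr fun w hw => hz w (Ideal.mem_sup_left hw)
    exact hw x fun v hv => hθ (by rw [map_smul, hz v (Ideal.mem_sup_right (hs hv)), map_zero])
  have h2 := (frobeniusPower_sup_le e _ _).trans
    (sup_le_sup_left (frobeniusPower_le_pow e (powIdeal_le_pow hy M)) _) h1
  obtain ⟨z, hz, μ, hμ, rfl⟩ := Submodule.mem_sup.mp (hM w fun g hg => by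
    obtain ⟨c, rfl⟩ := Ideal.mem_span_singleton'.mp hg
    rw [mul_left_comm]
    exact Ideal.mul_mem_left _ _ h2)
  refine ⟨z, fun x => ?_, by simpa using hμ⟩
  refine H.smul_frobenius_eq_zero (I := J) ?_ ((hrange _).mp ⟨x, rfl⟩)
  exact Submodule.mem_colon.mp hz u (Ideal.mem_span_singleton_self u)

end Fedder

/-! ### Completions of quotients, axiomatically -/

section Completion

open IsLocalRing

/-- `A` behaves like the completion of the quotient `W ⧸ J` of a local ring `W`. -/
structure IsQuotientCompletion {W A : Type*} [CommRing W] [IsLocalRing W] [CommRing A]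
    [IsLocalRing A] [Algebra W A] (J : Ideal W) : Prop where
  exists_sub_mem : ∀ s (a : A), ∃ w, a - algebraMap W A w ∈ maximalIdeal A ^ s
  algebraMap_mem_iff : ∀ s w, algebraMap W A w ∈ maximalIdeal A ^ s ↔ w ∈ J ⊔ maximalIdeal W ^ s
  exists_limit : ∀ c : ℕ → W, (∀ N, c (N + 1) - c N ∈ maximalIdeal W ^ N) →
    ∃ a : A, ∀ N, a - algebraMap W A (c N) ∈ maximalIdeal A ^ N
  eq_zero : ∀ a : A, (∀ s, a ∈ maximalIdeal A ^ s) → a = 0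

namespace IsQuotientCompletion

variable {W A : Type u} [CommRing W] [IsLocalRing W] [CommRing A] [IsLocalRing A] [Algebra W A]
  {J : Ideal W} (hA : IsQuotientCompletion (A := A) J)

include hA

theorem algebraMap_eq_zero {w : W} (hw : w ∈ J) : algebraMap W A w = 0 :=
  hA.eq_zero _ fun s => (hA.algebraMap_mem_iff s w).mpr (Ideal.mem_sup_left hw)

theorem algebraMap_mem_pow {s : ℕ} {w : W} (hw : w ∈ maximalIdeal W ^ s) :
    algebraMap W A w ∈ maximalIdeal A ^ s :=
  (hA.algebraMap_mem_iff s w).mpr (Ideal.mem_sup_right hw)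

theorem exists_mem_pow {s t : ℕ} (hst : s ≤ t) {a : A} (ha : a ∈ maximalIdeal A ^ s) :
    ∃ w ∈ maximalIdeal W ^ s, a - algebraMap W A w ∈ maximalIdeal A ^ t := by
  obtain ⟨w, hw⟩ := hA.exists_sub_mem t a
  have h1 : algebraMap W A w ∈ maximalIdeal A ^ s := by
    have := Ideal.sub_mem _ ha (Ideal.pow_le_pow_right hst hw)
    rwa [sub_sub_cancel] at this
  obtain ⟨j, hj, v, hv, rfl⟩ := Submodule.mem_sup.mp ((hA.algebraMap_mem_iff s w).mp h1)
  refine ⟨v, hv, ?_⟩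
  rwa [map_add, hA.algebraMap_eq_zero hj, zero_add] at hw

/-- Leading forms of elements of an ideal `𝔞` of `A` define a filtration of `W` contained in the
`𝔪`-adic one, hence stable. Lifts of its generators at the stable stage generate `𝔞 ⊓ 𝔪 ^ n₀` by
successive approximation, and finitely many more elements account for `𝔞` modulo `𝔪 ^ n₀`. -/
theorem isNoetherianRing [IsNoetherianRing W] : IsNoetherianRing A := by
  rw [isNoetherianRing_iff_ideal_fg]
  intro 𝔞
  set f := algebraMap W A with hf
  let Fil : (maximalIdeal W).Filtration W :=
    { N := fun n =>
        { carrier := {w | w ∈ maximalIdeal W ^ n ∧ ∃ x ∈ 𝔞, x - f w ∈ maximalIdeal A ^ (n + 1)}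
          zero_mem' := ⟨zero_mem _, 0, zero_mem _, by simp⟩
          add_mem' := by
            rintro a b ⟨ha, x, hx, hxa⟩ ⟨hb, y, hy, hyb⟩
            refine ⟨add_mem ha hb, x + y, add_mem hx hy, ?_⟩
            rw [map_add, add_sub_add_comm]
            exact add_mem hxa hyb
          smul_mem' := by
            rintro c a ⟨ha, x, hx, hxa⟩
            refine ⟨Ideal.mul_mem_left _ _ ha, f c * x, Ideal.mul_mem_left _ _ hx, ?_⟩
            rw [smul_eq_mul, map_mul, ← mul_sub]
            exact Ideal.mul_mem_left _ _ hxa }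
      mono := by
        rintro n w ⟨hw, x, hx, hxw⟩
        exact ⟨Ideal.pow_le_pow_right (Nat.le_succ n) hw, x, hx,
          Ideal.pow_le_pow_right (Nat.le_succ _) hxw⟩
      smul_le := by
        intro n
        refine Submodule.smul_le.mpr ?_
        rintro c hc w ⟨hw, x, hx, hxw⟩
        refine ⟨?_, f c * x, Ideal.mul_mem_left _ _ hx, ?_⟩
        · rw [pow_succ']; exact Ideal.mul_mem_mul hc hw
        · rw [smul_eq_mul, map_mul, ← mul_sub, pow_succ']
          refine Ideal.mul_mem_mul ?_ hxw
          simpa using hA.algebraMap_mem_pow (s := 1) (w := c) (by simpa using hc) }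
  have hFil : ∀ n w, w ∈ Fil.N n ↔
      w ∈ maximalIdeal W ^ n ∧ ∃ x ∈ 𝔞, x - f w ∈ maximalIdeal A ^ (n + 1) := fun n w => Iff.rfl
  obtain ⟨n₀, hn₀⟩ : Fil.Stable := by
    refine ((maximalIdeal W).stableFiltration_stable (⊤ : Submodule W W)).of_le ?_
    intro n w hw
    have : w ∈ (maximalIdeal W ^ n • ⊤ : Submodule W W) := by simpa using hw.1
    exact this
  have hpow : ∀ k, Fil.N (n₀ + k) = maximalIdeal W ^ k • Fil.N n₀ := by
    intro k
    induction k with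
    | zero => simp
    | succ k ih => rw [← add_assoc, ← hn₀ _ (by omega), ih, ← mul_smul, ← pow_succ']
  obtain ⟨r, s, hs⟩ := Submodule.fg_iff_exists_fin_generating_family.mp
    (IsNoetherian.noetherian (Fil.N n₀))
  have hsN : ∀ i, s i ∈ Fil.N n₀ := fun i => hs ▸ Submodule.subset_span ⟨i, rfl⟩
  choose _ x hx hxs using hsN
  -- One correction: the leading form of `z` is a combination of the `s i` with coefficients of
  -- order `k`, and subtracting the same combination of the lifts `x i` raises the order by one.
  have hstep : ∀ k, ∀ z, z ∈ 𝔞 ⊓ maximalIdeal A ^ (n₀ + k) → ∃ c : Fin r → W,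
      (∀ i, c i ∈ maximalIdeal W ^ k) ∧
        z - ∑ i, f (c i) * x i ∈ 𝔞 ⊓ maximalIdeal A ^ (n₀ + (k + 1)) := by
    rintro k z ⟨hz, hz'⟩
    obtain ⟨w, hw, hwz⟩ := hA.exists_mem_pow (Nat.le_succ _) hz'
    have hwN : w ∈ Fil.N (n₀ + k) := ⟨hw, z, hz, hwz⟩
    rw [hpow, ← hs] at hwN
    obtain ⟨c, hc, hcw⟩ := (Submodule.mem_ideal_smul_span_iff_exists_sum _ _ _).mp hwN
    rw [Finsupp.sum_fintype _ _ (by simp)] at hcw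
    refine ⟨c, hc, Ideal.sub_mem _ hz (Ideal.sum_mem _ fun i _ => Ideal.mul_mem_left _ _ (hx i)), ?_⟩
    have : z - ∑ i, f (c i) * x i = (z - f w) - ∑ i, f (c i) * (x i - f (s i)) := by
      rw [← hcw, map_sum]
      simp only [smul_eq_mul, map_mul, mul_sub, Finset.sum_sub_distrib]
      ring
    rw [this]
    refine Ideal.sub_mem _ hwz (Ideal.sum_mem _ fun i _ => ?_)
    have h1 := Ideal.mul_mem_mul (hA.algebraMap_mem_pow (hc i)) (hxs i)
    rw [← pow_add] at h1
    convert h1 using 2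
    ring
  choose! c hc hc' using hstep
  have hsmall : 𝔞 ⊓ maximalIdeal A ^ n₀ ≤ Ideal.span (Set.range x) := by
    intro z hz
    let X : ℕ → A := fun k => Nat.rec z (fun k v => v - ∑ i, f (c k v i) * x i) k
    have hXs : ∀ k, X (k + 1) = X k - ∑ i, f (c k (X k) i) * x i := fun k => rfl
    have hX : ∀ k, X k ∈ 𝔞 ⊓ maximalIdeal A ^ (n₀ + k) := by
      intro k
      induction k with
      | zero => exact hz
      | succ k ih => exact hc' k _ ih
    have hlim : ∀ i, ∃ a : A, ∀ K, a - f (∑ k ∈ Finset.range K, c k (X k) i) ∈ maximalIdeal A ^ K :=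
      fun i => hA.exists_limit _ fun K => by
        rw [Finset.sum_range_succ, add_sub_cancel_left]
        exact hc K _ (hX K) i
    choose a ha using hlim
    have hXK : ∀ K, z - ∑ i, f (∑ k ∈ Finset.range K, c k (X k) i) * x i = X K := by
      intro K
      induction K with
      | zero => simp [X]
      | succ K ih =>
        rw [hXs, ← ih, sub_sub, ← Finset.sum_add_distrib]
        congr 1
        refine Finset.sum_congr rfl fun i _ => ?_
        rw [Finset.sum_range_succ, map_add, add_mul, ih]
    have : z - ∑ i, a i * x i = 0 := by
      refine hA.eq_zero _ fun K => ?_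
      have h1 : z - ∑ i, a i * x i =
          X K - ∑ i, (a i - f (∑ k ∈ Finset.range K, c k (X k) i)) * x i := by
        rw [← hXK]
        simp only [sub_mul, Finset.sum_sub_distrib]
        ring
      rw [h1]
      exact Ideal.sub_mem _ (Ideal.pow_le_pow_right (by omega) (hX K).2)
        (Ideal.sum_mem _ fun i _ => Ideal.mul_mem_right _ _ (ha i K))
    rw [sub_eq_zero.mp this]
    exact Ideal.sum_mem _ fun i _ => Ideal.mul_mem_left _ _ (Ideal.subset_span ⟨i, rfl⟩)
  let N : Ideal W :=
    { carrier := {w | ∃ x ∈ 𝔞, x - f w ∈ maximalIdeal A ^ n₀}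
      zero_mem' := ⟨0, zero_mem _, by simp⟩
      add_mem' := by
        rintro a b ⟨x, hx, hxa⟩ ⟨y, hy, hyb⟩
        refine ⟨x + y, add_mem hx hy, ?_⟩
        rw [map_add, add_sub_add_comm]
        exact add_mem hxa hyb
      smul_mem' := by
        rintro c a ⟨x, hx, hxa⟩
        refine ⟨f c * x, Ideal.mul_mem_left _ _ hx, ?_⟩
        rw [smul_eq_mul, map_mul, ← mul_sub]
        exact Ideal.mul_mem_left _ _ hxa }
  obtain ⟨l, v, hv⟩ := Submodule.fg_iff_exists_fin_generating_family.mp (IsNoetherian.noetherian N)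
  have hvN : ∀ j, v j ∈ N := fun j => hv ▸ Submodule.subset_span ⟨j, rfl⟩
  choose x' hx' hxv using hvN
  have h𝔞 : 𝔞 = Ideal.span (Set.range x ∪ Set.range x') := by
    refine le_antisymm (fun z hz => ?_) (Ideal.span_le.mpr (Set.union_subset ?_ ?_))
    · obtain ⟨w, hw⟩ := hA.exists_sub_mem n₀ z
      have hwN : w ∈ Submodule.span W (Set.range v) := hv ▸ (⟨z, hz, hw⟩ : w ∈ N)
      obtain ⟨d, hd⟩ := (Submodule.mem_span_range_iff_exists_fun W).mp hwN
      have h1 : z - ∑ j, f (d j) * x' j ∈ Ideal.span (Set.range x) := by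
        refine hsmall ⟨Ideal.sub_mem _ hz (Ideal.sum_mem _ fun j _ =>
          Ideal.mul_mem_left _ _ (hx' j)), ?_⟩
        have : z - ∑ j, f (d j) * x' j = (z - f w) - ∑ j, f (d j) * (x' j - f (v j)) := by
          rw [← hd, map_sum]
          simp only [smul_eq_mul, map_mul, mul_sub, Finset.sum_sub_distrib]
          ring
        rw [this]
        exact Ideal.sub_mem _ hw (Ideal.sum_mem _ fun j _ => Ideal.mul_mem_left _ _ (hxv j))
      have h2 : ∑ j, f (d j) * x' j ∈ Ideal.span (Set.range x ∪ Set.range x') :=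
        Ideal.sum_mem _ fun j _ => Ideal.mul_mem_left _ _ (Ideal.subset_span (Or.inr ⟨j, rfl⟩))
      have := add_mem (Ideal.span_mono Set.subset_union_left h1) h2
      rwa [sub_add_cancel] at this
    · rintro _ ⟨i, rfl⟩; exact hx i
    · rintro _ ⟨i, rfl⟩; exact hx' i
  rw [h𝔞]
  exact Submodule.fg_span ((Set.finite_range x).union (Set.finite_range x'))

variable {E : Type u} [AddCommGroup E] [Module A E] [Module W E] [IsScalarTower W A E]

omit [IsLocalRing W] hA in
theorem smul_eq_smul {s : ℕ} {x : E} (hx : ∀ b ∈ maximalIdeal A ^ s, b • x = 0) {a : A} {w : W}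
    (haw : a - algebraMap W A w ∈ maximalIdeal A ^ s) : a • x = w • x := by
  have := hx _ haw
  rwa [sub_smul, sub_eq_zero, algebraMap_smul] at this

/-- Frobenius-semilinearity over `A` can be checked over `W`. -/
theorem mem_frobeniusHom {ι : ResidueField A →ₗ[A] E} [IsNoetherianRing A] (hι : IsInjectiveHull ι)
    {p e : ℕ} {φ : E →+ E} (hφ : ∀ (w : W) x, φ (w • x) = w ^ p ^ e • φ x) :
    φ ∈ frobeniusHom p A E e := by
  intro a x
  obtain ⟨s, hs⟩ := hι.exists_pow_smul_eq_zero x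
  obtain ⟨t, ht⟩ := hι.exists_pow_smul_eq_zero (φ x)
  obtain ⟨w, hw⟩ := hA.exists_sub_mem (s + t) a
  change φ (a • x) = a ^ p ^ e • φ x
  rw [smul_eq_smul hs (Ideal.pow_le_pow_right (Nat.le_add_right s t) hw), hφ]
  refine (smul_eq_smul ht ?_).symm
  rw [map_pow]
  exact Ideal.mem_of_dvd _ (sub_dvd_pow_sub_pow _ _ _)
    (Ideal.pow_le_pow_right (Nat.le_add_left t s) hw)

end IsQuotientCompletion

end Completion

/-! ### The Frobenius algebra of the hull over a completed quotient -/

section Main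

open IsLocalRing

namespace IsQuotientCompletion

variable {W A : Type u} [CommRing W] [IsLocalRing W] [IsNoetherianRing W] [CommRing A]
  [IsLocalRing A] [IsNoetherianRing A] [Algebra W A]
  {J : Ideal W} (hA : IsQuotientCompletion (A := A) J)
  {E : Type u} [AddCommGroup E] [Module A E] [Module W E] [IsScalarTower W A E]
  {ι : ResidueField A →ₗ[A] E} (hι : IsInjectiveHull ι)
  {p : ℕ} [Fact p.Prime] [CharP W p] {h : ℕ} {y : Fin h → W} {D : Type u} [AddCommGroup D]
  [Module W D] {δ : ℕ → W →ₗ[W] D} {F : D →+ D} (H : IsLocalCohomology p y δ F)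
  (hy : Ideal.span (Set.range y) = maximalIdeal W) (hflat : ∀ e, EqFlatPow W (p ^ e))
  (hmin : ∀ a : Fin h → W, ∑ i, a i * y i = 0 → ∀ i, a i ∈ maximalIdeal W)

include hA hι H hy hflat hmin

/-- The injective hull of the residue field of `A` is the `J`-torsion of the top local cohomology
of `W`. -/
theorem exists_embedding : ∃ θ : E →ₗ[W] D, Function.Injective θ ∧
    ∀ z, z ∈ LinearMap.range θ ↔ ∀ w ∈ J, w • z = 0 := by
  obtain ⟨κ, hκ⟩ := H.exists_isInjectiveHull hy hflat hmin
  obtain ⟨θ, hθ⟩ := hκ.injective_module.exists_comp_eq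
    (LinearMap.toSpanSingleton W E (ι 1)) (δ 1) (by
      intro w hw
      rw [LinearMap.mem_ker, LinearMap.toSpanSingleton_apply] at hw
      rw [LinearMap.mem_ker, H.delta_one_eq_zero_iff hy, mem_maximalIdeal]
      intro hu
      exact hι.map_one_ne_zero (hu.smul_eq_zero.mp hw))
  have hθ1 : θ (ι 1) = δ 1 1 := by simpa using hθ 1
  have hinj : Function.Injective θ := by
    rw [injective_iff_map_eq_zero]
    intro x hx
    by_contra hx0
    obtain ⟨a, ha⟩ := hι.exists_smul_eq hx0
    obtain ⟨s, hs⟩ := hι.exists_pow_smul_eq_zero x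
    obtain ⟨w, hw⟩ := hA.exists_sub_mem s a
    rw [smul_eq_smul hs hw] at ha
    apply H.delta_one_one_ne_zero hy
    rw [← hθ1, ← ha, map_smul, hx, smul_zero]
  refine ⟨θ, hinj, fun z => ⟨?_, fun hz => ?_⟩⟩
  · rintro ⟨x, rfl⟩ w hw
    rw [← map_smul, ← algebraMap_smul A w x, hA.algebraMap_eq_zero hw, zero_smul, map_zero]
  -- If `z` is outside the range, a map `g` on `D / θ T`, with `T` the `𝔪 ^ s`-torsion of `E`, does
  -- not kill it. On classes of denominator `s` this map is multiplication by some `t`; as `t` kills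
  -- `T`, duality over `A` gives `t ∈ J + 𝔪 ^ s`, which kills `z`.
  · by_contra hzr
    obtain ⟨s, hs⟩ := H.exists_pow_smul_eq_zero hy z
    let T : Submodule W E :=
      { carrier := {x | ∀ a ∈ maximalIdeal A ^ s, a • x = 0}
        zero_mem' := fun a _ => smul_zero a
        add_mem' := fun {x x'} hx hx' a ha => by rw [smul_add, hx a ha, hx' a ha, add_zero]
        smul_mem' := fun w x hx a ha => by
          rw [← algebraMap_smul A w x, smul_comm, hx a ha, smul_zero] }
    let N := T.map θ
    have hzN : N.mkQ z ≠ 0 := by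
      intro h0
      obtain ⟨x, -, hx⟩ := (Submodule.Quotient.mk_eq_zero N).mp h0
      exact hzr ⟨x, hx⟩
    obtain ⟨g, hg⟩ := hκ.exists_hom_ne_zero hzN
    have hpow := powIdeal_le_pow hy s
    obtain ⟨b, hb⟩ := H.exists_delta_eq hy hflat hmin (z := z) (s := s) fun w hw => hs w (hpow hw)
    obtain ⟨t, ht⟩ := H.exists_delta_eq hy hflat hmin (z := g (N.mkQ (δ s 1))) (s := s)
      fun w hw => by
        rw [← map_smul, ← map_smul, H.smul_eq_zero _ _ _ hw, map_zero, map_zero]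
    have hgt : ∀ b, g (N.mkQ (δ s b)) = t • δ s b := fun b => by
      calc g (N.mkQ (δ s b)) = b • g (N.mkQ (δ s 1)) := by
            rw [← map_smul, ← map_smul, ← map_smul, smul_eq_mul, mul_one]
        _ = t • δ s b := by
            rw [← ht, ← map_smul, ← map_smul, smul_eq_mul, smul_eq_mul, mul_comm]
    have htJ : t ∈ J ⊔ maximalIdeal W ^ s := by
      rw [← hA.algebraMap_mem_iff]
      by_contra htn
      obtain ⟨x, hx, htx⟩ := hι.exists_torsion_smul_ne_zero (maximalIdeal A ^ s) htn
      apply htx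
      apply hinj
      rw [algebraMap_smul, map_smul, map_zero]
      obtain ⟨b, hb⟩ := H.exists_delta_eq hy hflat hmin (z := θ x) (s := s) fun w hw => by
        rw [← map_smul, ← algebraMap_smul A w x, hx _ (hA.algebraMap_mem_pow (hpow hw)), map_zero]
      have hmk : N.mkQ (θ x) = 0 := (Submodule.Quotient.mk_eq_zero N).mpr ⟨x, hx, rfl⟩
      rw [← hb, ← hgt, hb, hmk, map_zero]
    obtain ⟨j, hj, v, hv, rfl⟩ := Submodule.mem_sup.mp htJ
    apply hg
    rw [← hb, hgt, hb, add_smul, hz j hj, hs v hv, add_zero]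

variable {θ : E →ₗ[W] D} (hθ : Function.Injective θ)
  (hrange : ∀ z, z ∈ LinearMap.range θ ↔ ∀ w ∈ J, w • z = 0)

include hθ hrange

/-- Multipliers `c N` valid on larger and larger torsion need not be Cauchy, but consecutive ones
differ, up to `𝔪 ^ N`, by some `z N` with `z N * u` acting as zero. Subtracting the partial sums of
the `z i` makes the sequence converge in `A`. -/
theorem exists_eq_smul {e : ℕ} {u : W}
    (hu : frobeniusColon p e J ≤ frobeniusPower p e J ⊔ Ideal.span {u}) {Ψ : E → E}
    (hΨ : ∀ x, θ (Ψ x) = u • F^[e] (θ x)) (φ : E →+ E)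
    (hφ : ∀ (w : W) x, φ (w • x) = w ^ p ^ e • φ x) : ∃ a : A, ∀ x, φ x = a • Ψ x := by
  choose s hs using H.exists_mem_sup_pow hy hflat hmin θ hθ hrange e u
  -- Chosen so that `S N` and `S (N + 1)` are both at least `s N`, making both multipliers valid on
  -- `𝔪 ^ (s N)`-torsion; the summand `N` makes the torsion bounds exhaust `E`.
  let S : ℕ → ℕ := fun N => N + ∑ i ∈ Finset.range (N + 1), s i
  have hsS : ∀ N, s N ≤ S N := fun N =>
    (Finset.single_le_sum (f := s) (fun _ _ => Nat.zero_le _)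
      (Finset.self_mem_range_succ N)).trans (Nat.le_add_left _ _)
  have hsS' : ∀ N, s N ≤ S (N + 1) := fun N =>
    (Finset.single_le_sum (f := s) (fun _ _ => Nat.zero_le _)
      (Finset.mem_range.mpr (by omega : N < N + 1 + 1))).trans (Nat.le_add_left _ _)
  choose c hc using fun N =>
    H.exists_eq_smul_mul_frobenius hy hflat hmin θ hθ hrange e hu φ hφ (S N)
  have hdiff : ∀ N, ∃ z, (∀ x, (z * u) • F^[e] (θ x) = 0) ∧
      c (N + 1) - c N - z ∈ maximalIdeal W ^ N := fun N =>
    hs N _ fun x hx => by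
      rw [sub_mul, sub_smul, ← hc, ← hc, sub_self]
      · exact fun w hw => hx w (Ideal.pow_le_pow_right (hsS N) hw)
      · exact fun w hw => hx w (Ideal.pow_le_pow_right (hsS' N) hw)
  choose z hz hz' using hdiff
  obtain ⟨a, ha⟩ := hA.exists_limit (fun N => c N - ∑ i ∈ Finset.range N, z i) fun N => by
    rw [Finset.sum_range_succ]
    convert hz' N using 1
    ring
  refine ⟨a, fun x => ?_⟩
  obtain ⟨t, ht⟩ := hι.exists_pow_smul_eq_zero x
  obtain ⟨r, hr⟩ := hι.exists_pow_smul_eq_zero (Ψ x)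
  rw [smul_eq_smul hr (Ideal.pow_le_pow_right (Nat.le_add_left r t) (ha (t + r)))]
  apply hθ
  rw [map_smul, hΨ, ← mul_smul, sub_mul, sub_smul, Finset.sum_mul, Finset.sum_smul,
    Finset.sum_eq_zero fun i _ => hz i x, sub_zero]
  refine hc _ x fun w hw => ?_
  rw [← algebraMap_smul A w x]
  refine ht _ (hA.algebraMap_mem_pow (Ideal.pow_le_pow_right ?_ hw))
  simp only [S]
  omega

omit hθ hrange

/-- If all the colon ideals `(J^[q] : J)` are generated, modulo `J^[q]`, by the powers
`u ^ (q - 1)`, then the Frobenius algebra is generated by one element. -/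
theorem frobeniusAlgebraFG {u : W}
    (hcolon : ∀ e, frobeniusColon p e J ≤ frobeniusPower p e J ⊔ Ideal.span {u ^ (p ^ e - 1)})
    (hu : u ^ (p - 1) ∈ frobeniusColon p 1 J) : FrobeniusAlgebraFG p A E := by
  classical
  obtain ⟨θ, hθ, hrange⟩ := hA.exists_embedding hι H hy hflat hmin
  have hp : 0 < p := (Fact.out : p.Prime).pos
  -- `u ^ (p - 1) F` preserves the `J`-torsion because `u ^ (p - 1) J ⊆ J^[p]`.
  have hex : ∀ x, ∃ x', θ x' = u ^ (p - 1) • F (θ x) := fun x => by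
    refine (hrange _).mpr fun w hw => ?_
    rw [← mul_smul, mul_comm]
    exact H.smul_frobenius_eq_zero (e := 1) (Submodule.mem_colon.mp hu w hw)
      ((hrange _).mp ⟨x, rfl⟩)
  choose ψ₀ hψ₀ using hex
  let ψ : AddMonoid.End E := AddMonoidHom.mk' ψ₀ fun x x' => hθ (by
    rw [map_add, hψ₀, hψ₀, hψ₀, map_add, map_add, smul_add])
  have hψ : ∀ x, θ (ψ x) = u ^ (p - 1) • F (θ x) := hψ₀
  -- The exponents add up by `(p - 1) + p (p ^ e - 1) = p ^ (e + 1) - 1`.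
  have hiter : ∀ e x, θ ((ψ ^ e) x) = u ^ (p ^ e - 1) • F^[e] (θ x) := by
    intro e x
    induction e with
    | zero => simp
    | succ e ih =>
      have hF := H.frobenius_pow_smul 1
      simp only [Function.iterate_one, pow_one] at hF
      rw [pow_succ', AddMonoid.End.coe_mul, Function.comp_apply, hψ, ih, hF, ← mul_smul, ← pow_mul, ← pow_add,
        Function.iterate_succ_apply']
      congr 2
      have h1 : 0 < p ^ e := pow_pos hp e
      obtain ⟨m, hm⟩ := Nat.exists_eq_add_of_lt h1
      obtain ⟨l, rfl⟩ := Nat.exists_eq_add_of_lt hp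
      rw [pow_succ, hm]
      simp only [zero_add, Nat.add_sub_cancel]
      rw [show (m + 1) * (l + 1) = (l + m * (l + 1)) + 1 by ring, Nat.add_sub_cancel]
  have hψmem : ψ ∈ frobeniusHom p A E 1 := hA.mem_frobeniusHom hι fun w x => hθ (by
    have hF := H.frobenius_pow_smul 1
    simp only [Function.iterate_one] at hF
    calc θ (ψ (w • x)) = w ^ p ^ 1 • θ (ψ x) := by rw [hψ, hψ, map_smul, hF, smul_comm]
      _ = θ (w ^ p ^ 1 • ψ x) := (map_smul θ _ _).symm)
  refine ⟨{DirectSum.of (fun e => frobeniusHom p A E e) 1 ⟨ψ, hψmem⟩}, ?_⟩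
  rw [eq_top_iff]
  rintro f -
  induction f using DirectSum.induction_on with
  | zero => exact zero_mem _
  | add f g hf hg => exact add_mem hf hg
  | of e φ =>
    obtain ⟨a, ha⟩ := hA.exists_eq_smul hι H hy hflat hmin hθ hrange (hcolon e) (hiter e)
      φ.1 (fun w x => by
        have := φ.2 (algebraMap W A w) x
        rw [algebraMap_smul, ← map_pow, algebraMap_smul] at this
        exact this)
    have : DirectSum.of (fun e => frobeniusHom p A E e) e φ =
        frobeniusAlgebraMap p A E a *
          DirectSum.of (fun e => frobeniusHom p A E e) 1 ⟨ψ, hψmem⟩ ^ e := by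
      rw [DirectSum.ofPow]
      change _ = DirectSum.of (fun e => frobeniusHom p A E e) 0 _ * _
      rw [DirectSum.of_mul_of]
      have hdeg : e = 0 + e • 1 := by simp
      refine DirectSum.of_eq_of_gradedMonoid_eq (Sigma.subtype_ext hdeg ?_)
      exact AddMonoidHom.ext ha
    rw [this]
    refine mul_mem (Subring.subset_closure (Or.inl ⟨a, rfl⟩)) (Subring.pow_mem _ ?_ e)
    exact Subring.subset_closure (Or.inr (Finset.mem_coe.mpr (Finset.mem_singleton_self _)))

end IsQuotientCompletion

end Main

/-! ### Colon ideals of square-free monomial ideals -/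

section Span

variable {R : Type*} [CommRing R] {p : ℕ} [Fact p.Prime] [CharP R p]

theorem frobeniusPower_span (e : ℕ) (S : Set R) :
    frobeniusPower p e (Ideal.span S) = Ideal.span ((· ^ p ^ e) '' S) := by
  refine le_antisymm (Ideal.span_le.mpr ?_) (Ideal.span_le.mpr ?_)
  · rintro _ ⟨a, ha, rfl⟩
    rw [SetLike.mem_coe]
    induction ha using Submodule.span_induction with
    | mem x hx => exact Ideal.subset_span ⟨x, hx, rfl⟩
    | zero =>
      rw [zero_pow (pow_pos (Fact.out : p.Prime).pos e).ne']
      exact zero_mem _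
    | add x y _ _ hx hy => rw [add_pow_char_pow]; exact add_mem hx hy
    | smul c x _ hx => rw [smul_eq_mul, mul_pow]; exact Ideal.mul_mem_left _ _ hx
  · rintro _ ⟨a, ha, rfl⟩
    exact Ideal.subset_span ⟨a, Ideal.subset_span ha, rfl⟩

omit [Fact p.Prime] [CharP R p] in
theorem mem_frobeniusColon_span {e : ℕ} {S : Set R} {r : R} :
    r ∈ frobeniusColon p e (Ideal.span S) ↔ ∀ s ∈ S, r * s ∈ frobeniusPower p e (Ideal.span S) := by
  refine ⟨fun h s hs => Submodule.mem_colon.mp h s (Ideal.subset_span hs), fun h => ?_⟩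
  refine Submodule.mem_colon.mpr fun x hx => ?_
  rw [SetLike.mem_coe] at hx
  rw [smul_eq_mul]
  generalize hT : frobeniusPower p e (Ideal.span S) = T at h
  induction hx using Submodule.span_induction with
  | mem x hx => exact h x hx
  | zero => rw [mul_zero]; exact zero_mem _
  | add x y _ _ hx hy => rw [mul_add]; exact add_mem hx hy
  | smul c x _ hx => rw [smul_eq_mul, mul_left_comm]; exact Ideal.mul_mem_left _ _ hx

end Span

section Monomial

open MvPolynomial

variable {k : Type*} [Field k] {n : ℕ}

/-- The exponent with value `q` on `g` and `0` elsewhere. -/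
noncomputable def powExp {σ : Type*} [Finite σ] [DecidableEq σ] (g : Finset σ) (q : ℕ) : σ →₀ ℕ :=
  Finsupp.equivFunOnFinite.symm fun i => if i ∈ g then q else 0

theorem powExp_apply {σ : Type*} [Finite σ] [DecidableEq σ] (g : Finset σ) (q : ℕ) (i : σ) :
    powExp g q i = if i ∈ g then q else 0 := rfl

theorem powExp_le_iff {σ : Type*} [Finite σ] [DecidableEq σ] {g : Finset σ} {q : ℕ} {a : σ →₀ ℕ} :
    powExp g q ≤ a ↔ ∀ i ∈ g, q ≤ a i := by
  refine ⟨fun h i hi => by simpa [powExp_apply, hi] using h i, fun h i => ?_⟩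
  rw [powExp_apply]
  split_ifs with hi
  · exact h i hi
  · exact Nat.zero_le _

theorem sqfreeMonomial_pow (g : Finset (Fin n)) (q : ℕ) :
    sqfreeMonomial k g ^ q = monomial (powExp g q) 1 := by
  rw [sqfreeMonomial, ← Finset.prod_pow, monomial_eq, C_1, one_mul,
    Finsupp.prod_fintype _ _ (by simp)]
  simp [powExp_apply, pow_ite, Finset.prod_ite_mem]

theorem sqfreeMonomial_eq (g : Finset (Fin n)) :
    sqfreeMonomial k g = monomial (powExp g 1) 1 := by
  rw [← sqfreeMonomial_pow, pow_one]

theorem setOne_monomial (d : Finset (Fin n)) (a : Fin n →₀ ℕ) (c : k) :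
    setOne k d (monomial a c) = monomial (a.subtypeDomain (· ∈ d)) c := by
  rw [setOne, aeval_monomial, monomial_eq (a := c), Finsupp.prod_fintype _ _ (by simp),
    Finsupp.prod_fintype _ _ (by simp)]
  congr 1
  rw [← Finset.prod_subset (Finset.subset_univ d)]
  · rw [← Finset.prod_attach]
    refine Finset.prod_congr rfl fun i _ => ?_
    simp
  · intro i _ hi
    simp [hi]

theorem exists_of_coeff_setOne_ne_zero {d : Finset (Fin n)} {f : MvPolynomial (Fin n) k}
    {b : {i // i ∈ d} →₀ ℕ} (h : coeff b (setOne k d f) ≠ 0) :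
    ∃ a ∈ f.support, a.subtypeDomain (· ∈ d) = b := by
  by_contra! hcon
  apply h
  conv_lhs => rw [f.as_sum, map_sum, coeff_sum]
  refine Finset.sum_eq_zero fun a ha => ?_
  rw [setOne_monomial, coeff_monomial, if_neg (hcon a ha)]

variable {p : ℕ} [Fact p.Prime] [CharP k p]

theorem frobeniusPower_span_sqfreeMonomial (e : ℕ) (G : Set (Finset (Fin n))) :
    frobeniusPower p e (Ideal.span (sqfreeMonomial k '' G)) =
      Ideal.span ((fun a => monomial a (1 : k)) '' ((powExp · (p ^ e)) '' G)) := by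
  rw [frobeniusPower_span, Set.image_image, Set.image_image]
  simp only [sqfreeMonomial_pow]

theorem exists_of_mem_frobeniusColon {G : Set (Finset (Fin n))} {e : ℕ}
    {f : MvPolynomial (Fin n) k} (hf : f ∈ frobeniusColon p e (Ideal.span (sqfreeMonomial k '' G)))
    {a : Fin n →₀ ℕ} (ha : a ∈ f.support) : ∀ g ∈ G, ∃ h ∈ G, powExp h (p ^ e) ≤ a + powExp g 1 := by
  intro g hg
  have h1 := mem_frobeniusColon_span.mp hf _ ⟨g, hg, rfl⟩
  rw [frobeniusPower_span_sqfreeMonomial, mem_ideal_span_monomial_image, sqfreeMonomial_eq] at h1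
  obtain ⟨_, ⟨h, hh, rfl⟩, hle⟩ := h1 (a + powExp g 1) (by
    rw [mem_support_iff, coeff_mul_monomial, mul_one]
    exact mem_support_iff.mp ha)
  exact ⟨h, hh, hle⟩

theorem monomial_mem_frobeniusColon {G : Set (Finset (Fin n))} {e : ℕ} {a : Fin n →₀ ℕ}
    (ha : ∀ g ∈ G, ∃ h ∈ G, powExp h (p ^ e) ≤ a + powExp g 1) :
    monomial a (1 : k) ∈ frobeniusColon p e (Ideal.span (sqfreeMonomial k '' G)) := by
  refine mem_frobeniusColon_span.mpr ?_
  rintro _ ⟨g, hg, rfl⟩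
  rw [frobeniusPower_span_sqfreeMonomial, mem_ideal_span_monomial_image, sqfreeMonomial_eq,
    monomial_mul]
  intro b hb
  obtain rfl := Finset.mem_singleton.mp (support_monomial_subset hb)
  obtain ⟨h, hh, hle⟩ := ha g hg
  exact ⟨_, ⟨h, hh, rfl⟩, hle⟩

variable {G : Set (Finset (Fin n))} {d β : Finset (Fin n)}
  (hd : (frobeniusColon p 1 (Ideal.span (sqfreeMonomial k '' G))).map (setOne k d) =
    frobeniusPower p 1 ((Ideal.span (sqfreeMonomial k '' G)).map (setOne k d)) ⊔
      Ideal.span {setOne k d (sqfreeMonomial k β) ^ (p - 1)})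

include hd

/-- `q h ≤ a + g` says that `a_i ≥ q - 1` on `h ∩ g` and `a_i ≥ q` on `h \ g`. Testing the
hypothesis on one exponent with prescribed level sets yields a statement about subsets in which `p`
no longer occurs, ready for every `q`. -/
theorem subset_or_subset_of_colon {A₁ A₂ : Finset (Fin n)} (hA : A₂ ⊆ A₁)
    (hG : ∀ g ∈ G, ∃ h ∈ G, h ∩ g ⊆ A₁ ∧ h \ g ⊆ A₂) :
    (∃ h ∈ G, h ∩ d ⊆ A₂) ∨ β ∩ d ⊆ A₁ := by
  have hp : 2 ≤ p := (Fact.out : p.Prime).two_le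
  -- An exponent with `{a_i ≥ p} = A₂` and `{a_i ≥ p - 1} = A₁`; the second equality needs `p - 1 >
  -- 0`.
  let a : Fin n →₀ ℕ :=
    Finsupp.equivFunOnFinite.symm fun i => if i ∈ A₂ then p else if i ∈ A₁ then p - 1 else 0
  have ha : ∀ i, a i = if i ∈ A₂ then p else if i ∈ A₁ then p - 1 else 0 := fun i => rfl
  have ha2 : ∀ i, p ≤ a i → i ∈ A₂ := by
    intro i hi
    rw [ha] at hi
    by_contra h
    rw [if_neg h] at hi
    split_ifs at hi <;> omega
  have ha1 : ∀ i, p - 1 ≤ a i → i ∈ A₁ := by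
    intro i hi
    rw [ha] at hi
    by_contra h
    rw [if_neg fun h2 => h (hA h2), if_neg h] at hi
    omega
  have hmem := Ideal.mem_map_of_mem (setOne k d) (monomial_mem_frobeniusColon (k := k) (p := p)
    (e := 1) (G := G) (a := a) (by
      intro g hg
      obtain ⟨h, hh, h1, h2⟩ := hG g hg
      refine ⟨h, hh, powExp_le_iff.mpr fun i hi => ?_⟩
      rw [pow_one, Finsupp.add_apply, powExp_apply, ha]
      by_cases hig : i ∈ g
      · have := h1 (Finset.mem_inter.mpr ⟨hi, hig⟩)
        rw [if_pos hig, if_pos this]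
        split_ifs <;> omega
      · rw [if_pos (h2 (Finset.mem_sdiff.mpr ⟨hi, hig⟩))]
        omega))
  rw [hd, Ideal.map_span, frobeniusPower_span, Set.image_image, Set.image_image,
    ← map_pow, sqfreeMonomial_pow] at hmem
  simp only [← map_pow, sqfreeMonomial_pow, setOne_monomial, pow_one] at hmem
  rw [← Ideal.span_union, ← Set.image_singleton (f := fun b => monomial b (1 : k)),
    ← Set.image_image (fun b => monomial b (1 : k)), ← Set.image_union,
    mem_ideal_span_monomial_image] at hmem
  obtain ⟨b, hb | hb, hle⟩ := hmem (a.subtypeDomain (· ∈ d)) (by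
    rw [mem_support_iff, coeff_monomial, if_pos rfl]; exact one_ne_zero)
  · obtain ⟨h, hh, rfl⟩ := hb
    refine Or.inl ⟨h, hh, fun i hi => ha2 i ?_⟩
    obtain ⟨hi, hid⟩ := Finset.mem_inter.mp hi
    have := hle ⟨i, hid⟩
    simpa [powExp_apply, hi] using this
  · obtain rfl := hb
    refine Or.inr fun i hi => ha1 i ?_
    obtain ⟨hi, hid⟩ := Finset.mem_inter.mp hi
    have := hle ⟨i, hid⟩
    simpa [powExp_apply, hi] using this

/-- Some exponent of an element of the colon ideal restricts to `(p - 1) β` on `d`. Adding `g`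
reaches `p` at a place of `d` only where both `β` and `g` are present. -/
theorem exists_inter_subset_of_colon : ∀ g ∈ G, ∃ h ∈ G, h ∩ d ⊆ g ∩ β := by
  have hp : 2 ≤ p := (Fact.out : p.Prime).two_le
  have h1 : setOne k d (sqfreeMonomial k β) ^ (p - 1) ∈
      (frobeniusColon p 1 (Ideal.span (sqfreeMonomial k '' G))).map (setOne k d) := by
    rw [hd]
    exact Ideal.mem_sup_right (Ideal.mem_span_singleton_self _)
  obtain ⟨f, hf, hfβ⟩ := (Ideal.mem_map_iff_of_surjective _ (setOne_surjective k d)).mp h1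
  rw [← map_pow, sqfreeMonomial_pow, setOne_monomial] at hfβ
  obtain ⟨a, ha, hab⟩ := exists_of_coeff_setOne_ne_zero (f := f)
    (b := (powExp β (p - 1)).subtypeDomain (· ∈ d)) (by
      rw [hfβ, coeff_monomial, if_pos rfl]; exact one_ne_zero)
  intro g hg
  obtain ⟨h, hh, hle⟩ := exists_of_mem_frobeniusColon hf ha g hg
  refine ⟨h, hh, fun i hi => ?_⟩
  obtain ⟨hi, hid⟩ := Finset.mem_inter.mp hi
  have h2 := powExp_le_iff.mp hle i hi
  have h3 := DFunLike.congr_fun hab ⟨i, hid⟩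
  simp only [Finsupp.subtypeDomain_apply] at h3
  rw [pow_one, Finsupp.add_apply, h3, powExp_apply, powExp_apply] at h2
  rw [Finset.mem_inter]
  split_ifs at h2 with h4 h5
  · exact ⟨h5, h4⟩
  all_goals omega

end Monomial

/-! ### Colon ideals in localizations of power series rings -/

section PowerSeries

open MvPowerSeries

variable {k : Type*} [Field k] {n : ℕ}

theorem powExp_pow (g : Finset (Fin n)) (q : ℕ) :
    monomial (powExp g 1) (1 : k) ^ q = monomial (powExp g q) 1 := by
  rw [monomial_pow, one_pow]
  congr 2
  ext i
  simp [powExp_apply]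

variable {W : Type*} [CommRing W] [Algebra (MvPowerSeries (Fin n) k) W]

theorem algebraMap_monomial_mem_of_le {a b : Fin n →₀ ℕ} (hab : a ≤ b) {I : Ideal W}
    (ha : algebraMap _ W (monomial a (1 : k)) ∈ I) : algebraMap _ W (monomial b (1 : k)) ∈ I := by
  rw [← tsub_add_cancel_of_le hab, ← mul_one (1 : k), ← monomial_mul_monomial, map_mul]
  exact Ideal.mul_mem_left _ _ ha

variable {p : ℕ} [Fact p.Prime] [CharP W p] {G : Set (Finset (Fin n))} {d β : Finset (Fin n)}
  {J : Ideal W}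
  (hJ : J = Ideal.span ((fun g => algebraMap _ W (monomial (powExp g 1) (1 : k))) '' G))
  (hunit : IsUnit (algebraMap _ W (monomial (powExp dᶜ 1) (1 : k))))

include hJ

theorem frobeniusPower_eq_span (e : ℕ) : frobeniusPower p e J =
    Ideal.span ((fun g => algebraMap _ W (monomial (powExp g (p ^ e)) (1 : k))) '' G) := by
  rw [hJ, frobeniusPower_span, Set.image_image]
  simp only [← map_pow, powExp_pow]

include hunit

/-- The variables outside `d` are units in `W` and may be dropped from the generators of `J^[q]`. -/
theorem algebraMap_monomial_inter_mem {e : ℕ} {h : Finset (Fin n)} (hh : h ∈ G) :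
    algebraMap _ W (monomial (powExp (h ∩ d) (p ^ e)) (1 : k)) ∈ frobeniusPower p e J := by
  have hu : IsUnit (algebraMap _ W (monomial (powExp dᶜ (p ^ e)) (1 : k))) := by
    rw [← powExp_pow, map_pow]
    exact hunit.pow _
  refine (Ideal.unit_mul_mem_iff_mem _ hu).mp ?_
  rw [← map_mul, monomial_mul_monomial, mul_one]
  refine algebraMap_monomial_mem_of_le (a := powExp h (p ^ e)) ?_ ?_
  · refine powExp_le_iff.mpr fun i hi => ?_
    rw [Finsupp.add_apply, powExp_apply, powExp_apply]
    by_cases hid : i ∈ d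
    · rw [if_pos (Finset.mem_inter.mpr ⟨hi, hid⟩)]
      exact Nat.le_add_left _ _
    · rw [if_pos (Finset.mem_compl.mpr hid)]
      exact Nat.le_add_right _ _
  · rw [frobeniusPower_eq_span hJ]
    exact Ideal.subset_span ⟨h, hh, rfl⟩

theorem pow_mem_frobeniusColon (hG : ∀ g ∈ G, ∃ h ∈ G, h ∩ d ⊆ g ∩ β) :
    algebraMap _ W (monomial (powExp (β ∩ d) 1) (1 : k)) ^ (p - 1) ∈ frobeniusColon p 1 J := by
  have hp : 2 ≤ p := (Fact.out : p.Prime).two_le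
  rw [hJ, mem_frobeniusColon_span]
  rintro _ ⟨g, hg, rfl⟩
  rw [← hJ, ← map_pow, powExp_pow, ← map_mul, monomial_mul_monomial, mul_one]
  obtain ⟨h, hh, hle⟩ := hG g hg
  refine algebraMap_monomial_mem_of_le ?_ (algebraMap_monomial_inter_mem hJ hunit hh)
  refine powExp_le_iff.mpr fun i hi => ?_
  obtain ⟨hig, hiβ⟩ := Finset.mem_inter.mp (hle hi)
  have hid := (Finset.mem_inter.mp hi).2
  rw [Finsupp.add_apply, powExp_apply, powExp_apply, if_pos hig,
    if_pos (Finset.mem_inter.mpr ⟨hiβ, hid⟩), pow_one]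
  omega

/-- After clearing denominators, membership in the colon becomes a condition on each exponent of a
power series. The subset statement then makes every such exponent divisible by a generator of
`J^[q]` with its part outside `d` removed, or by `u ^ (q - 1)`. -/
theorem frobeniusColon_le_sup_span (M : Submonoid (MvPowerSeries (Fin n) k)) [IsLocalization M W]
    (hG : ∀ A₁ A₂ : Finset (Fin n), A₂ ⊆ A₁ →
      (∀ g ∈ G, ∃ h ∈ G, h ∩ g ⊆ A₁ ∧ h \ g ⊆ A₂) → (∃ h ∈ G, h ∩ d ⊆ A₂) ∨ β ∩ d ⊆ A₁) (e : ℕ) :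
    frobeniusColon p e J ≤ frobeniusPower p e J ⊔
      Ideal.span {algebraMap _ W (monomial (powExp (β ∩ d) 1) (1 : k)) ^ (p ^ e - 1)} := by
  classical
  intro w hw
  obtain ⟨⟨f, s⟩, hfs⟩ := IsLocalization.surj M w
  have hs : IsUnit (algebraMap _ W (s : MvPowerSeries (Fin n) k)) := IsLocalization.map_units W s
  have hex : ∀ g : G, ∃ m ∈ M, m * (f * monomial (powExp (g : Finset (Fin n)) 1) 1) ∈
      Ideal.span ((fun a => monomial a (1 : k)) '' ((powExp · (p ^ e)) '' G)) := by
    intro g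
    rw [← IsLocalization.algebraMap_mem_map_algebraMap_iff M W, Ideal.map_span,
      Set.image_image, Set.image_image, ← frobeniusPower_eq_span hJ, map_mul, ← hfs]
    refine Submodule.mem_colon.mp (Ideal.mul_mem_right _ _ hw) _ ?_
    rw [hJ]
    exact Ideal.subset_span ⟨g, g.2, rfl⟩
  choose m hm hmem using hex
  have : Fintype G := Fintype.ofFinite G
  have hmu : IsUnit (algebraMap _ W (∏ g, m g)) :=
    IsLocalization.map_units W (⟨∏ g, m g, prod_mem fun g _ => hm g⟩ : M)
  have hmem' : ∀ g ∈ G, ((∏ g, m g) * f) * monomial (powExp g 1) 1 ∈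
      Ideal.span ((fun a => monomial a (1 : k)) '' ((powExp · (p ^ e)) '' G)) := by
    intro g hg
    rw [← Finset.mul_prod_erase _ _ (Finset.mem_univ (⟨g, hg⟩ : G)), mul_assoc, mul_assoc,
      mul_left_comm]
    exact Ideal.mul_mem_left _ _ (hmem ⟨g, hg⟩)
  refine (Ideal.unit_mul_mem_iff_mem _ hs).mp ?_
  rw [mul_comm, hfs]
  refine (Ideal.unit_mul_mem_iff_mem _ hmu).mp ?_
  rw [← map_mul]
  have key := mem_span_monomial
    (insert (powExp (β ∩ d) (p ^ e - 1)) ((Set.toFinite G).toFinset.image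
      fun h => powExp (h ∩ d) (p ^ e))) ((∏ g, m g) * f) (by
    intro a ha
    have hcond : ∀ g ∈ G, ∃ h ∈ G, powExp h (p ^ e) ≤ a + powExp g 1 := by
      intro g hg
      obtain ⟨_, ⟨h, hh, rfl⟩, hle⟩ := exists_le_of_mem_span_monomial (hmem' g hg)
        (d := a + powExp g 1) (by rwa [coeff_add_mul_monomial, mul_one])
      exact ⟨h, hh, hle⟩
    -- The level sets of `a` at `q - 1` and `q` play the roles of `A₁` and `A₂`.
    obtain ⟨h, hh, hle⟩ | hle := hG (Finset.univ.filter fun i => p ^ e - 1 ≤ a i)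
      (Finset.univ.filter fun i => p ^ e ≤ a i)
      (fun i hi => by
        simp only [Finset.mem_filter, Finset.mem_univ, true_and] at hi ⊢
        omega) (by
      intro g hg
      obtain ⟨h, hh, hle⟩ := hcond g hg
      refine ⟨h, hh, fun i hi => ?_, fun i hi => ?_⟩
      · obtain ⟨hi, hig⟩ := Finset.mem_inter.mp hi
        have := powExp_le_iff.mp hle i hi
        rw [Finsupp.add_apply, powExp_apply, if_pos hig] at this
        simp only [Finset.mem_filter, Finset.mem_univ, true_and]
        omega
      · obtain ⟨hi, hig⟩ := Finset.mem_sdiff.mp hi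
        have := powExp_le_iff.mp hle i hi
        rw [Finsupp.add_apply, powExp_apply, if_neg hig] at this
        simpa using this)
    · refine ⟨_, Finset.mem_insert_of_mem (Finset.mem_image_of_mem _
        ((Set.Finite.mem_toFinset _).mpr hh)), powExp_le_iff.mpr fun i hi => ?_⟩
      simpa using hle hi
    · refine ⟨_, Finset.mem_insert_self _ _, powExp_le_iff.mpr fun i hi => ?_⟩
      have := hle hi
      simp only [Finset.mem_filter, Finset.mem_univ, true_and] at this
      exact this)
  have := Ideal.mem_map_of_mem (algebraMap (MvPowerSeries (Fin n) k) W) key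
  rw [Ideal.map_span] at this
  refine (Ideal.span_le (I := frobeniusPower p e J ⊔ Ideal.span {algebraMap _ W
    (monomial (powExp (β ∩ d) 1) (1 : k)) ^ (p ^ e - 1)})).mpr ?_ this
  rintro _ ⟨_, ⟨a, ha, rfl⟩, rfl⟩
  rw [SetLike.mem_coe]
  obtain rfl | ha := Finset.mem_insert.mp ha
  · refine Ideal.mem_sup_right ?_
    beta_reduce
    rw [← map_pow, powExp_pow]
    exact Ideal.subset_span rfl
  · obtain ⟨h, hh, rfl⟩ := Finset.mem_image.mp ha
    exact Ideal.mem_sup_left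
      (algebraMap_monomial_inter_mem hJ hunit ((Set.Finite.mem_toFinset _).mp hh))

end PowerSeries

/-! ### Completions of quotients -/

section AdicCompletion

open IsLocalRing

theorem AdicCompletion.mem_maximalIdeal_pow_iff {S : Type u} [CommRing S] [IsLocalRing S]
    [IsNoetherianRing S] {s : ℕ} {a : AdicCompletion (maximalIdeal S) S} :
    a ∈ maximalIdeal (AdicCompletion (maximalIdeal S) S) ^ s ↔ evalₐ (maximalIdeal S) s a = 0 := by
  rw [maximalIdeal_eq_map, ← Ideal.map_pow, ← Submodule.restrictScalars_mem S,
    ← Ideal.smul_top_eq_map, pow_smul_top_eq_ker_eval (maximalIdeal S).fg_of_isNoetherianRing,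
    LinearMap.mem_ker]
  have h : (maximalIdeal S ^ s • ⊤ : Ideal S) = maximalIdeal S ^ s := by ext x; simp
  exact (map_eq_zero_iff (Ideal.quotientEquivAlgOfEq S h) (AlgEquiv.injective _)).symm

/-- The completion of a Noetherian local quotient of a local ring. -/
theorem isQuotientCompletion_adicCompletion {W S : Type u} [CommRing W] [IsLocalRing W]
    [CommRing S] [IsLocalRing S] [IsNoetherianRing S]
    [Algebra W (AdicCompletion (maximalIdeal S) S)] {f : W →+* S} (hf : Function.Surjective f)
    (halg : ∀ w, algebraMap W (AdicCompletion (maximalIdeal S) S) w = algebraMap S _ (f w)) :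
    IsQuotientCompletion (A := AdicCompletion (maximalIdeal S) S) (RingHom.ker f) := by
  have hloc : IsLocalHom f := hf.isLocalHom
  have hmap : ∀ s, (maximalIdeal W ^ s).map f = maximalIdeal S ^ s := fun s => by
    rw [Ideal.map_pow, map_maximalIdeal_of_surjective f hf]
  have hev : ∀ s w, AdicCompletion.evalₐ (maximalIdeal S) s (algebraMap W _ w) =
      Ideal.Quotient.mk _ (f w) := fun s w => by
    rw [halg, AlgHom.commutes]; rfl
  refine ⟨fun s a => ?_, fun s w => ?_, fun c hc => ?_, fun a ha => ?_⟩
  · obtain ⟨x, hx⟩ := Ideal.Quotient.mk_surjective (AdicCompletion.evalₐ (maximalIdeal S) s a)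
    obtain ⟨w, rfl⟩ := hf x
    exact ⟨w, AdicCompletion.mem_maximalIdeal_pow_iff.mpr (by rw [map_sub, hev, hx, sub_self])⟩
  · rw [AdicCompletion.mem_maximalIdeal_pow_iff, hev, Ideal.Quotient.eq_zero_iff_mem, ← hmap,
      ← Ideal.mem_comap, Ideal.comap_map_of_surjective' f hf, sup_comm]
  · have hcauchy : ∀ N, f (c N) ≡ f (c (N + 1)) [SMOD (maximalIdeal S ^ N • ⊤ : Ideal S)] := by
      intro N
      rw [SModEq.comm, SModEq.sub_mem, ← map_sub]
      have := Ideal.mem_map_of_mem f (hc N)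
      rw [hmap] at this
      simpa using this
    refine ⟨AdicCompletion.mk _ _ (AdicCompletion.AdicCauchySequence.mk (maximalIdeal S) S
      (fun N => f (c N)) hcauchy), fun N => AdicCompletion.mem_maximalIdeal_pow_iff.mpr ?_⟩
    rw [map_sub, hev, AdicCompletion.evalₐ_mk]
    exact sub_self _
  · refine AdicCompletion.ext_evalₐ fun s => ?_
    rw [map_zero]
    exact AdicCompletion.mem_maximalIdeal_pow_iff.mp (ha s)

theorem Localization.localRingHom_surjective {R R' : Type*} [CommRing R] [CommRing R']
    {f : R →+* R'} (hf : Function.Surjective f) (Q : Ideal R') [Q.IsPrime] :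
    Function.Surjective (Localization.localRingHom (Q.comap f) Q f rfl) := by
  intro x
  obtain ⟨r, s, rfl⟩ := IsLocalization.exists_mk'_eq Q.primeCompl x
  obtain ⟨r, rfl⟩ := hf r
  obtain ⟨s, hs⟩ := s
  obtain ⟨s, rfl⟩ := hf s
  exact ⟨IsLocalization.mk' _ r (⟨s, hs⟩ : (Q.comap f).primeCompl), by
    rw [Localization.localRingHom_mk']⟩

theorem Localization.ker_localRingHom {R R' : Type*} [CommRing R] [CommRing R']
    {f : R →+* R'} (hf : Function.Surjective f) (Q : Ideal R') [Q.IsPrime] :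
    RingHom.ker (Localization.localRingHom (Q.comap f) Q f rfl) =
      (RingHom.ker f).map (algebraMap R (Localization.AtPrime (Q.comap f))) := by
  refine IsLocalization.ker_map (T := Q.primeCompl) _ _ (SetLike.ext fun x => ⟨?_, fun hx => ?_⟩)
  · rintro ⟨y, hy, rfl⟩
    exact hy
  · obtain ⟨y, rfl⟩ := hf x
    exact ⟨y, hx, rfl⟩

end AdicCompletion

/-! ### Assembly of the criterion and the theorem -/

theorem IsQuotientCompletion.hasFGFrobeniusAlgebra {W A : Type u} [CommRing W] [IsLocalRing W]
    [IsNoetherianRing W] [CommRing A] [IsLocalRing A] [Algebra W A] {J : Ideal W}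
    (hA : IsQuotientCompletion (A := A) J) {p : ℕ} [Fact p.Prime] [CharP W p]
    (hflat : ∀ e, EqFlatPow W (p ^ e)) {u : W}
    (hcolon : ∀ e, frobeniusColon p e J ≤ frobeniusPower p e J ⊔ Ideal.span {u ^ (p ^ e - 1)})
    (hu : u ^ (p - 1) ∈ frobeniusColon p 1 J) : HasFGFrobeniusAlgebra p A := by
  have := hA.isNoetherianRing
  intro E _ _ ι hι
  let _ : Module W E := Module.compHom E (algebraMap W A)
  have : IsScalarTower W A E := ⟨fun w a x => by rw [Algebra.smul_def, mul_smul]; rfl⟩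
  obtain ⟨h, y, hy, hmin⟩ := exists_minimal_generators (W := W)
  obtain ⟨D, _, _, δ, F, H⟩ := exists_isLocalCohomology p hflat hy hmin
  exact hA.frobeniusAlgebraFG hι H hy hflat hmin hcolon hu

/-- A criterion for the Frobenius algebra of the completion of a quotient `W ⧸ J` to be finitely
generated. -/
theorem hasFGFrobeniusAlgebra_adicCompletion {W S : Type u} [CommRing W] [IsLocalRing W]
    [IsNoetherianRing W] [CommRing S] [IsLocalRing S] [IsNoetherianRing S] {f : W →+* S}
    (hf : Function.Surjective f) {J : Ideal W} (hJ : RingHom.ker f = J) {p : ℕ} [Fact p.Prime]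
    [CharP W p] (hflat : ∀ e, EqFlatPow W (p ^ e)) {u : W}
    (hcolon : ∀ e, frobeniusColon p e J ≤ frobeniusPower p e J ⊔ Ideal.span {u ^ (p ^ e - 1)})
    (hu : u ^ (p - 1) ∈ frobeniusColon p 1 J) :
    HasFGFrobeniusAlgebra p (AdicCompletion (IsLocalRing.maximalIdeal S) S) := by
  subst hJ
  let _ : Algebra W (AdicCompletion (IsLocalRing.maximalIdeal S) S) :=
    ((algebraMap S (AdicCompletion (IsLocalRing.maximalIdeal S) S)).comp f).toAlgebra
  exact (isQuotientCompletion_adicCompletion hf fun w => rfl).hasFGFrobeniusAlgebra hflat hcolon hu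

theorem theorem2p7 {k : Type*} [Field k] (p : ℕ) [Fact p.Prime] [CharP k p] (n : ℕ)
    (I : Ideal (MvPolynomial (Fin n) k)) (hI : IsFaceIdeal I)
    (d : Finset (Fin n))
    (hd : ∃ β' : Finset (Fin n),
      (frobeniusColon p 1 I).map (setOne k d) =
        frobeniusPower p 1 (I.map (setOne k d)) ⊔
          Ideal.span {setOne k d (sqfreeMonomial k β') ^ (p - 1)}) :
    (PrimeSpectrum.basicOpen (toCompletedFaceRing I (sqfreeMonomial k dᶜ)) :
        Set (PrimeSpectrum (CompletedFaceRing I))) ⊆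
      fgLocus p (CompletedFaceRing I) := by
  intro Q hQ
  obtain ⟨G, hI⟩ := hI
  obtain ⟨β, hd⟩ := hd
  rw [hI] at hd
  have hIG : I.map (MvPolynomial.coeToMvPowerSeries.ringHom (R := k)) =
      Ideal.span ((fun g => MvPowerSeries.monomial (powExp g 1) (1 : k)) '' G) := by
    rw [hI, Ideal.map_span, Set.image_image]
    simp [sqfreeMonomial_eq]
  let f : MvPowerSeries (Fin n) k →+* CompletedFaceRing I := Ideal.Quotient.mk _
  have hf : Function.Surjective f := Ideal.Quotient.mk_surjective
  -- The local ring of the power series ring at the preimage of `Q`; it surjects onto `Ŝ_Q` with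
  -- kernel the extension of `I`.
  let W := Localization.AtPrime (Q.asIdeal.comap f)
  have hker : RingHom.ker (Localization.localRingHom (Q.asIdeal.comap f) Q.asIdeal f rfl) = _ :=
    Localization.ker_localRingHom hf Q.asIdeal
  rw [Ideal.mk_ker] at hker
  have : IsNoetherianRing W := IsLocalization.isNoetherianRing (Q.asIdeal.comap f).primeCompl W
    inferInstance
  have : CharP W p := charP_of_injective_ringHom
    ((algebraMap (MvPowerSeries (Fin n) k) W).comp MvPowerSeries.C).injective p
  have hJ : (I.map (MvPolynomial.coeToMvPowerSeries.ringHom (R := k))).map (algebraMap _ W) =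
      Ideal.span ((fun g => algebraMap _ W (MvPowerSeries.monomial (powExp g 1) (1 : k))) '' G) := by
    refine (congrArg (Ideal.map (algebraMap _ W)) hIG).trans ?_
    rw [Ideal.map_span, Set.image_image]
  -- The only place where `Q ∈ D(x^{d⁺})` enters.
  have hunit : IsUnit (algebraMap _ W (MvPowerSeries.monomial (powExp dᶜ 1) (1 : k))) := by
    refine IsLocalization.map_units W (⟨_, ?_⟩ : (Q.asIdeal.comap f).primeCompl)
    intro h
    refine hQ ?_
    rw [sqfreeMonomial_eq]
    change f (MvPolynomial.coeToMvPowerSeries.ringHom _) ∈ Q.asIdeal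
    rw [MvPolynomial.coeToMvPowerSeries.ringHom_apply, MvPolynomial.coe_monomial]
    exact h
  exact hasFGFrobeniusAlgebra_adicCompletion (Localization.localRingHom_surjective hf Q.asIdeal) hker
    (fun e => (MvPowerSeries.eqFlatPow p e).of_isLocalization (Q.asIdeal.comap f).primeCompl W)
    (frobeniusColon_le_sup_span hJ hunit (Q.asIdeal.comap f).primeCompl
      fun A₁ A₂ => subset_or_subset_of_colon hd)
    (pow_mem_frobeniusColon hJ hunit (exists_inter_subset_of_colon hd))
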